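/- Let $G$ be an infinite compact (Hausdorff) abelian group with normalized Haar measure $m$, let $\Gamma$ be its dual group, i.e. the group of all continuous homomorphisms from $G$ into the circle group $\mathbb T$, let $\Lambda\subset\Gamma$, and put $\Lambda^{-1}=\{\gamma^{-1}:\gamma\in\Lambda\}$. Let $C(G)$ be the Banach space of continuous functions $f:G\to\mathbb C$ with the supremum norm and $$C_\Lambda(G)=\Bigl\{f\in C(G):\ \int_G f\,\overline{\gamma}\,dm=0\ \text{ for all }\gamma\in\Gamma\setminus\Lambda\Bigr\}.$$ Then $C_\Lambda(G)$ is a rich subspace of $C(G)$ if and only if $\Gamma\setminus\Lambda^{-1}$ is a semi-Riesz set. Here a Banach space $X$ has the Daugavet property if $\|\mathrm{Id}+T\|=1+\|T\|$ for every bounded linear operator $T:X\to X$ of rank one. A closed subspace $Y$ of a Banach space $X$ with the Daugavet property is called rich in $X$ if the quotient map $\pi:X\to X/Y$ is narrow, that is, if for all $x,y\in X$ with $\|x\|=\|y\|=1$, every $x^*\in X^*$ and every $\varepsilon>0$ there is $z\in X$ with $\|z\|=1$, $\|\pi(y-z)\|+|x^*(y-z)|\le\varepsilon$ and $\|x+z\|\ge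 2-\varepsilon$; in particular, the assertion that $Y$ is rich in $X$ includes that $X$ has the Daugavet property and that $Y$ is closed. A set $\Theta\subset\Gamma$ is a semi-Riesz set if every regular complex Borel measure $\mu$ on $G$ with $\int_G\overline{\gamma}\,d\mu=0$ for all $\gamma\in\Gamma\setminus\Theta$ is diffuse, i.e. satisfies $\mu(B)=0$ for all countable sets $B\subset G$. -/

import Mathlib

open MeasureTheory
open scoped Pointwise ComplexConjugate

namespace HarmonicBanach

noncomputable section

/-! ### The Daugavet property, narrow operators and rich subspaces -/

section Banach

variable (X : Type*) [NormedAddCommGroup X] [NormedSpace ℂ X]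

/-- A Banach space `X` has the Daugavet property if every bounded operator `T` on `X` of rank one
satisfies the Daugavet equation `‖Id + T‖ = 1 + ‖T‖`. -/
def HasDaugavetProperty : Prop :=
  ∀ T : X →L[ℂ] X, Module.finrank ℂ (LinearMap.range (T : X →ₗ[ℂ] X)) = 1 →
    ‖ContinuousLinearMap.id ℂ X + T‖ = 1 + ‖T‖

variable {X}

/-- A bounded operator `T` is narrow if for all `x, y` in the unit sphere of `X`, every
continuous linear functional `φ` and every `ε > 0` there is `z` in the unit sphere with
`‖T (y - z)‖ + |φ (y - z)| ≤ ε` and `‖x + z‖ ≥ 2 - ε`. -/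
def IsNarrow {E : Type*} [SeminormedAddCommGroup E] [NormedSpace ℂ E] (T : X →L[ℂ] E) : Prop :=
  ∀ x ∈ Metric.sphere (0 : X) 1, ∀ y ∈ Metric.sphere (0 : X) 1, ∀ φ : X →L[ℂ] ℂ,
    ∀ ε : ℝ, 0 < ε → ∃ z ∈ Metric.sphere (0 : X) 1,
      ‖T (y - z)‖ + ‖φ (y - z)‖ ≤ ε ∧ 2 - ε ≤ ‖x + z‖

/-- `Y` is a rich subspace of the Banach space `X`: the ambient space `X` has the Daugavet
property, `Y` is closed, and the quotient map `X → X ⧸ Y` (with the quotient norm on `X ⧸ Y`)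
is narrow. -/
structure IsRich (Y : Submodule ℂ X) : Prop where
  daugavet : HasDaugavetProperty X
  isClosed : IsClosed (Y : Set X)
  narrow : IsNarrow Y.mkQL

end Banach

/-! ### Spectra of functions and measures on a compact abelian group -/

section Group

variable {G : Type*} [CommGroup G] [TopologicalSpace G] [IsTopologicalGroup G] [CompactSpace G]
  [MeasurableSpace G] [BorelSpace G]

variable (G) in
/-- The Haar measure of `G`, normalized to have total mass one. -/
def normalizedHaar : Measure G := Measure.haarMeasure (⊤ : TopologicalSpace.PositiveCompacts G)

/-- The Fourier coefficient `∫ conj γ · f dm` of a continuous function `f`. -/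
def fourierCoefficient (f : C(G, ℂ)) (γ : PontryaginDual G) : ℂ :=
  ∫ x, conj (γ x : ℂ) * f x ∂(normalizedHaar G)

/-- The spectrum of a continuous function. -/
def spec (f : C(G, ℂ)) : Set (PontryaginDual G) :=
  {γ | fourierCoefficient f γ ≠ 0}

instance : IsFiniteMeasure (normalizedHaar G) := by
  unfold normalizedHaar
  infer_instance

instance : IsProbabilityMeasure (normalizedHaar G) :=
  ⟨by simpa [normalizedHaar] using
    Measure.haarMeasure_self (K₀ := (⊤ : TopologicalSpace.PositiveCompacts G))⟩

lemma integrable_conj_mul (f : C(G, ℂ)) (γ : PontryaginDual G) :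
    Integrable (fun x => conj (γ x : ℂ) * f x) (normalizedHaar G) := by
  have hc : Continuous (fun x => conj (γ x : ℂ) * f x) :=
    (Complex.continuous_conj.comp (continuous_subtype_val.comp (map_continuous γ))).mul
      f.continuous
  exact hc.integrable_of_hasCompactSupport (HasCompactSupport.of_compactSpace _)

lemma fourierCoefficient_zero (γ : PontryaginDual G) :
    fourierCoefficient (0 : C(G, ℂ)) γ = 0 := by
  simp [fourierCoefficient]

lemma fourierCoefficient_add (f g : C(G, ℂ)) (γ : PontryaginDual G) :
    fourierCoefficient (f + g) γ = fourierCoefficient f γ + fourierCoefficient g γ := by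
  simp only [fourierCoefficient, ContinuousMap.add_apply, mul_add]
  exact integral_add (integrable_conj_mul f γ) (integrable_conj_mul g γ)

lemma fourierCoefficient_smul (c : ℂ) (f : C(G, ℂ)) (γ : PontryaginDual G) :
    fourierCoefficient (c • f) γ = c * fourierCoefficient f γ := by
  simp only [fourierCoefficient, ContinuousMap.smul_apply, smul_eq_mul, mul_left_comm _ c]
  exact integral_const_mul c _

/-- `C_Λ(G)`: the continuous functions on `G` with spectrum contained in `Λ`. -/
def continuousWithSpec (Λ : Set (PontryaginDual G)) : Submodule ℂ C(G, ℂ) where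
  carrier := {f | spec f ⊆ Λ}
  zero_mem' := fun γ hγ => (hγ (fourierCoefficient_zero γ)).elim
  add_mem' := by
    intro f g hf hg γ hγ
    by_contra h
    have h1 : fourierCoefficient f γ = 0 := by_contra fun h' => h (hf h')
    have h2 : fourierCoefficient g γ = 0 := by_contra fun h' => h (hg h')
    exact hγ (by rw [fourierCoefficient_add, h1, h2, add_zero])
  smul_mem' := by
    intro c f hf γ hγ
    refine hf fun h => hγ ?_
    rw [fourierCoefficient_smul, h, mul_zero]

end Group

section Measures

variable {G : Type*} [CommGroup G] [TopologicalSpace G] [MeasurableSpace G]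

/-- A complex Borel measure is regular if its total variation is a regular measure. The space
`M(G)` consists of the regular complex Borel measures on `G`. -/
def IsRegularMeasure (μ : ComplexMeasure G) : Prop := μ.variation.Regular

/-- The Fourier-Stieltjes transform `∫ conj γ dμ` of a complex measure. -/
def fourierStieltjes (μ : ComplexMeasure G) (γ : PontryaginDual G) : ℂ :=
  μ.integral (fun x => conj (γ x : ℂ)) (ContinuousLinearMap.mul ℝ ℂ)

/-- The spectrum of a complex measure. -/
def measureSpec (μ : ComplexMeasure G) : Set (PontryaginDual G) :=
  {γ | fourierStieltjes μ γ ≠ 0}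

/-- A complex measure is diffuse (non-atomic) if it vanishes on all countable sets. -/
def IsDiffuse (μ : ComplexMeasure G) : Prop :=
  ∀ B : Set G, B.Countable → μ B = 0

/-- `Λ` is a semi-Riesz set if every `μ ∈ M(G)` with spectrum contained in `Λ` is diffuse. -/
def IsSemiRiesz (Λ : Set (PontryaginDual G)) : Prop :=
  ∀ μ : ComplexMeasure G, IsRegularMeasure μ → measureSpec μ ⊆ Λ → IsDiffuse μ

end Measures

end

end HarmonicBanach

/-!
By the Riesz representation theorem, the annihilator of `C_Λ(G)` consists of the regular complex
measures whose spectrum avoids `Λ⁻¹`, because the characters of `G` span a dense subspace of `C(G)`.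
By the Stone–Weierstrass theorem this only requires that characters separate points: the
translations of `L²(G)` generate a commutative C⋆-algebra, and each multiplicative functional that
does not vanish on all operators `∫ f(s) V(s) ds`, where `V` is the regular representation,
restricts to a continuous character of `G`.

An operator on `C(K)` is narrow as soon as every nonempty open set carries a bump on which the
operator and a prescribed functional `φ` are both small; conversely, a narrow operator is almost
zero on suitable functions that are bounded, peak in a given open set and are small off it.
If the quotient map is narrow, such peaks can be translated to any point `x`, and an annihilating
measure, which is small on them, has no atom at `x`. If all annihilating measures are diffuse,
choose a point `t` of the open set that is not an atom of the measure representing `φ`: each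
functional on `C(G) / C_Λ(G) × ℂ`, composed with the quotient map and `φ`, is small on bumps
concentrated at `t`, and by the Hahn–Banach theorem weak smallness on a convex set of bumps yields
one bump that is small in norm.
-/

namespace HarmonicBanach

/-! ### The Riesz representation theorem for complex functionals -/

section PosPart

lemma Icc_zero_add {α : Type*} [AddCommGroup α] [Lattice α] [IsOrderedAddMonoid α] {f g : α}
    (hf : 0 ≤ f) (hg : 0 ≤ g) : Set.Icc 0 (f + g) = Set.Icc 0 f + Set.Icc 0 g := by
  refine Set.Subset.antisymm ?_ ?_
  · rintro k ⟨hk0, hk⟩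
    refine ⟨k ⊓ f, ⟨le_inf hk0 hf, inf_le_right⟩, k - k ⊓ f,
      ⟨sub_nonneg.2 inf_le_left, sub_le_comm.1 (le_inf ?_ (sub_le_iff_le_add.2 hk))⟩,
      add_sub_cancel _ _⟩
    exact sub_le_self k hg
  · rintro _ ⟨a, ha, b, hb, rfl⟩
    exact ⟨add_nonneg ha.1 hb.1, add_le_add ha.2 hb.2⟩

variable {K : Type*} [TopologicalSpace K]

/-- The positive part, in the Riesz decomposition, of a bounded functional `u` on `C(K, ℝ)`. The
formula is meaningful only at functions `f ≥ 0`. -/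
noncomputable def posPartFunctional (u : C(K, ℝ) →L[ℝ] ℝ) (f : C(K, ℝ)) : ℝ :=
  sSup (u '' Set.Icc 0 f)

variable (u : C(K, ℝ) →L[ℝ] ℝ)

lemma posPartFunctional_smul {c : ℝ} (hc : 0 ≤ c) (f : C(K, ℝ)) :
    posPartFunctional u (c • f) = c * posPartFunctional u f := by
  rcases hc.eq_or_lt with rfl | hc
  · simp [posPartFunctional]
  have hIcc : Set.Icc 0 (c • f) = c • Set.Icc 0 f := by
    have h : c • Set.Icc 0 f = Set.Icc (c • 0) (c • f) := (OrderIso.smulRight hc).image_Icc 0 f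
    rw [h, smul_zero]
  rw [posPartFunctional, hIcc, Set.image_smul_comm _ _ _ (map_smul u c),
    Real.sSup_smul_of_nonneg hc.le, smul_eq_mul, posPartFunctional]

variable [CompactSpace K]

lemma bddAbove_image_Icc (f : C(K, ℝ)) : BddAbove (u '' Set.Icc 0 f) := by
  refine ⟨‖u‖ * ‖f‖, ?_⟩
  rintro _ ⟨g, ⟨hg0, hgf⟩, rfl⟩
  have hgf' : ‖g‖ ≤ ‖f‖ := (ContinuousMap.norm_le _ (norm_nonneg f)).2 fun x =>
    (Real.norm_of_nonneg (hg0 x)).trans_le ((hgf x).trans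
      ((le_abs_self _).trans (f.norm_coe_le_norm x)))
  exact (le_abs_self _).trans (u.le_opNorm_of_le hgf')

lemma le_posPartFunctional {f g : C(K, ℝ)} (hg : g ∈ Set.Icc 0 f) : u g ≤ posPartFunctional u f :=
  le_csSup (bddAbove_image_Icc u f) ⟨g, hg, rfl⟩

lemma posPartFunctional_nonneg {f : C(K, ℝ)} (hf : 0 ≤ f) : 0 ≤ posPartFunctional u f :=
  (map_zero u).symm.trans_le (le_posPartFunctional u ⟨le_rfl, hf⟩)

lemma posPartFunctional_le_add {f : C(K, ℝ)} (hf : 0 ≤ f) :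
    posPartFunctional u f ≤ u f + posPartFunctional (-u) f := by
  refine csSup_le ⟨u 0, 0, ⟨le_rfl, hf⟩, rfl⟩ ?_
  rintro _ ⟨g, ⟨hg0, hgf⟩, rfl⟩
  have h : (-u) (f - g) ≤ posPartFunctional (-u) f :=
    le_posPartFunctional (-u) ⟨sub_nonneg.2 hgf, sub_le_self _ hg0⟩
  rw [neg_apply, map_sub] at h
  linarith

lemma posPartFunctional_sub_posPartFunctional_neg {f : C(K, ℝ)} (hf : 0 ≤ f) :
    posPartFunctional u f - posPartFunctional (-u) f = u f := by
  have h := posPartFunctional_le_add u hf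
  have h' := posPartFunctional_le_add (-u) hf
  rw [neg_neg, neg_apply] at h'
  linarith

lemma posPartFunctional_add {f g : C(K, ℝ)} (hf : 0 ≤ f) (hg : 0 ≤ g) :
    posPartFunctional u (f + g) = posPartFunctional u f + posPartFunctional u g := by
  have hne {h : C(K, ℝ)} (hh : 0 ≤ h) : (u '' Set.Icc 0 h).Nonempty := ⟨_, 0, ⟨le_rfl, hh⟩, rfl⟩
  rw [posPartFunctional, Icc_zero_add hf hg, Set.image_add]
  exact csSup_add (hne hf) (bddAbove_image_Icc u f) (hne hg) (bddAbove_image_Icc u g)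

end PosPart

section PositiveMeasures

open scoped NNReal

variable {K : Type*} [TopologicalSpace K] [CompactSpace K] [MeasurableSpace K]

lemma integrable_continuousMap [OpensMeasurableSpace K] {E : Type*} [NormedAddCommGroup E]
    (ν : Measure K) [IsFiniteMeasure ν] (f : C(K, E)) : Integrable f ν :=
  f.continuous.integrable_of_hasCompactSupport (HasCompactSupport.of_compactSpace _)

variable [T2Space K] [BorelSpace K]

lemma exists_measure_of_posFunctional (p : C(K, ℝ) → ℝ) (hp : ∀ f, 0 ≤ f → 0 ≤ p f)
    (hadd : ∀ f g, 0 ≤ f → 0 ≤ g → p (f + g) = p f + p g)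
    (hsmul : ∀ c : ℝ, 0 ≤ c → ∀ f, 0 ≤ f → p (c • f) = c * p f) :
    ∃ ν : Measure K, ν.Regular ∧ IsFiniteMeasure ν ∧
      ∀ f : C(K, ℝ), 0 ≤ f → ∫ x, f x ∂ν = p f := by
  let toReal (f : C(K, ℝ≥0)) : C(K, ℝ) := ⟨fun x => (f x : ℝ), by fun_prop⟩
  have toReal_nonneg (f : C(K, ℝ≥0)) : 0 ≤ toReal f := fun x => (f x).2
  let P : CompactlySupportedContinuousMap K ℝ≥0 →ₗ[ℝ≥0] ℝ≥0 :=
    { toFun := fun f => ⟨p (toReal f.toContinuousMap), hp _ (toReal_nonneg _)⟩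
      map_add' := fun f g => NNReal.eq (hadd _ _ (toReal_nonneg _) (toReal_nonneg _))
      map_smul' := fun c f => NNReal.eq (hsmul c c.2 _ (toReal_nonneg _)) }
  have hreg : (NNRealRMK.rieszMeasure P).Regular := NNRealRMK.rieszMeasure_regular P
  refine ⟨NNRealRMK.rieszMeasure P, hreg, ⟨isCompact_univ.measure_lt_top⟩, fun f hf => ?_⟩
  lift f to C(K, ℝ≥0) using hf
  exact NNRealRMK.integral_rieszMeasure P
    (CompactlySupportedContinuousMap.continuousMapEquiv f)

lemma exists_measures_of_real_functional (u : C(K, ℝ) →L[ℝ] ℝ) :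
    ∃ ν₁ ν₂ : Measure K, ν₁.Regular ∧ IsFiniteMeasure ν₁ ∧ ν₂.Regular ∧ IsFiniteMeasure ν₂ ∧
      ∀ f : C(K, ℝ), u f = ∫ x, f x ∂ν₁ - ∫ x, f x ∂ν₂ := by
  have hpos (v : C(K, ℝ) →L[ℝ] ℝ) := exists_measure_of_posFunctional (posPartFunctional v)
    (fun f => posPartFunctional_nonneg v) (fun f g => posPartFunctional_add v)
    (fun c hc f _ => posPartFunctional_smul v hc f)
  obtain ⟨ν₁, hreg₁, hfin₁, h₁⟩ := hpos u
  obtain ⟨ν₂, hreg₂, hfin₂, h₂⟩ := hpos (-u)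
  refine ⟨ν₁, ν₂, hreg₁, hfin₁, hreg₂, hfin₂, fun f => ?_⟩
  have integral_eq (ν : Measure K) [IsFiniteMeasure ν] :
      ∫ x, f x ∂ν = ∫ x, f⁺ x ∂ν - ∫ x, f⁻ x ∂ν := by
    rw [← integral_sub (integrable_continuousMap ν _) (integrable_continuousMap ν _)]
    exact congrArg (fun g : C(K, ℝ) => ∫ x, g x ∂ν) (posPart_sub_negPart f).symm
  rw [integral_eq ν₁, integral_eq ν₂, h₁ _ (posPart_nonneg f), h₁ _ (negPart_nonneg f),
    h₂ _ (posPart_nonneg f), h₂ _ (negPart_nonneg f), sub_sub_sub_comm,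
    posPartFunctional_sub_posPartFunctional_neg u (posPart_nonneg f),
    posPartFunctional_sub_posPartFunctional_neg u (negPart_nonneg f), ← map_sub,
    posPart_sub_negPart]

end PositiveMeasures

section ComplexMeasures

variable {K : Type*} [MeasurableSpace K]

lemma withDensityᵥ_const_apply (ν : Measure K) [IsFiniteMeasure ν] (c : ℂ) {s : Set K}
    (hs : MeasurableSet s) : ν.withDensityᵥ (fun _ => c) s = ν.real s * c := by
  rw [withDensityᵥ_apply (integrable_const c) hs, setIntegral_const, Complex.real_smul]

lemma variation_withDensityᵥ_const (ν : Measure K) [IsFiniteMeasure ν] (c : ℂ) :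
    (ν.withDensityᵥ fun _ => c).variation = ‖c‖ₑ • ν := by
  rw [Measure.variation_withDensityᵥ (integrable_const c), withDensity_const]

lemma integral_withDensityᵥ_const (ν : Measure K) [IsFiniteMeasure ν] (c : ℂ) {f : K → ℂ}
    (hf : Integrable f ν) :
    (ν.withDensityᵥ fun _ => c).integral f (ContinuousLinearMap.mul ℝ ℂ) = c * ∫ x, f x ∂ν := by
  set μ : ComplexMeasure K := ν.withDensityᵥ fun _ => c
  have hT : DominatedFinMeasAdditive ν (μ.transpose (ContinuousLinearMap.mul ℝ ℂ)) ‖c‖ := by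
    rw [transpose_eq_cbmApplyMeasure]
    refine ⟨fun s t hs ht _ _ hst => cbmApplyMeasure_union _ _ hs ht hst,
      fun s hs _ => (norm_cbmApplyMeasure_le _ _ _).trans_eq ?_⟩
    rw [withDensityᵥ_const_apply ν c hs, ContinuousLinearMap.opNorm_mul, one_mul, norm_mul,
      Complex.norm_real, Real.norm_of_nonneg measureReal_nonneg, mul_comm]
  have integral_eq : μ.integral f (ContinuousLinearMap.mul ℝ ℂ) = setToFun ν _ hT f :=
    (setToFun_congr_measure_of_integrable ‖c‖ₑ (by simp)
      (variation_withDensityᵥ_const ν c).le hT _ f hf).symm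
  rw [integral_eq]
  refine Integrable.induction (fun f => setToFun ν _ hT f = c * ∫ x, f x ∂ν)
    (fun a s hs hs_lt => ?_) (fun f g _ hf hg ihf ihg => ?_)
    (isClosed_eq (continuous_setToFun hT) (continuous_const.mul continuous_integral))
    (fun f g hfg _ ihf => ?_) hf
  · rw [setToFun_indicator_const hT hs hs_lt.ne, integral_indicator_const _ hs,
      transpose_eq_cbmApplyMeasure, cbmApplyMeasure_apply,
      withDensityᵥ_const_apply ν c hs, ContinuousLinearMap.mul_apply', Complex.real_smul]
    ring
  · rw [setToFun_add hT hf hg, ihf, ihg, ← mul_add, integral_add' hf hg]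
  · rw [← setToFun_congr_ae hT hfg, ihf, integral_congr_ae hfg]

lemma variation_singleton_eq_zero [MeasurableSingletonClass K] {μ : ComplexMeasure K} {t : K}
    (h : μ {t} = 0) : μ.variation {t} = 0 := by
  rw [VectorMeasure.variation_apply_eq_zero (measurableSet_singleton t)]
  intro s hs _
  rcases Set.subset_singleton_iff_eq.1 hs with rfl | rfl
  · exact μ.empty
  · exact h

/-- The integral of a continuous function with respect to a complex measure: the duality between
`C(K, ℂ)` and the complex measures on `K`. -/
noncomputable def pairing [TopologicalSpace K] (μ : ComplexMeasure K) (f : C(K, ℂ)) : ℂ :=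
  μ.integral f (ContinuousLinearMap.mul ℝ ℂ)

lemma norm_pairing_le_integral_norm [TopologicalSpace K] (μ : ComplexMeasure K) (f : C(K, ℂ)) :
    ‖pairing μ f‖ ≤ ∫ x, ‖f x‖ ∂μ.variation := by
  simpa only [pairing, ContinuousLinearMap.opNorm_mul, one_mul] using
    VectorMeasure.norm_integral_le_integral_norm (μ := μ) (f := f)
      (B := ContinuousLinearMap.mul ℝ ℂ)

variable [TopologicalSpace K] [CompactSpace K]

lemma norm_pairing_le_variation_mul_norm (μ : ComplexMeasure K) [IsFiniteMeasure μ.variation]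
    (f : C(K, ℂ)) : ‖pairing μ f‖ ≤ μ.variation.real Set.univ * ‖f‖ := by
  simpa only [pairing, ContinuousLinearMap.opNorm_mul, mul_one, mul_comm _ ‖f‖] using
    VectorMeasure.norm_integral_le_of_norm_le_const (μ := μ) (B := ContinuousLinearMap.mul ℝ ℂ)
      (.of_forall f.norm_coe_le_norm)

lemma IsRegularMeasure.isFiniteMeasure_variation {μ : ComplexMeasure K}
    (hμ : IsRegularMeasure μ) : IsFiniteMeasure μ.variation :=
  have : μ.variation.Regular := hμ
  ⟨isCompact_univ.measure_lt_top⟩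

variable [OpensMeasurableSpace K]

/-- Integration against a regular complex measure as a bounded functional on `C(K, ℂ)`. -/
noncomputable def pairingCLM (μ : ComplexMeasure K) (hμ : IsRegularMeasure μ) :
    C(K, ℂ) →L[ℂ] ℂ :=
  have := hμ.isFiniteMeasure_variation
  LinearMap.mkContinuous
    { toFun := pairing μ
      map_add' := fun f g => VectorMeasure.integral_add (integrable_continuousMap _ f)
        (integrable_continuousMap _ g)
      map_smul' := fun c f => by
        refine setToFun_smul (𝕜 := ℂ) _ (fun c s x => ?_) c f
        rw [transpose_eq_cbmApplyMeasure, cbmApplyMeasure_apply, cbmApplyMeasure_apply,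
          ContinuousLinearMap.mul_apply', ContinuousLinearMap.mul_apply', smul_mul_assoc] }
    (μ.variation.real Set.univ) (norm_pairing_le_variation_mul_norm μ)

@[simp]
lemma pairingCLM_apply {μ : ComplexMeasure K} (hμ : IsRegularMeasure μ) (f : C(K, ℂ)) :
    pairingCLM μ hμ f = pairing μ f := rfl

lemma pairing_add_measure {μ ν : ComplexMeasure K} (hμ : IsRegularMeasure μ)
    (hν : IsRegularMeasure ν) (f : C(K, ℂ)) :
    pairing (μ + ν) f = pairing μ f + pairing ν f :=
  have := hμ.isFiniteMeasure_variation
  have := hν.isFiniteMeasure_variation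
  VectorMeasure.integral_add_vectorMeasure (integrable_continuousMap _ f)
    (integrable_continuousMap _ f)

/-- The inclusion of the real continuous functions into the complex ones. -/
noncomputable def complexify (K : Type*) [TopologicalSpace K] : C(K, ℝ) →L[ℝ] C(K, ℂ) :=
  Complex.ofRealCLM.compLeftContinuous ℝ K

@[simp]
lemma complexify_apply {K : Type*} [TopologicalSpace K] (f : C(K, ℝ)) (x : K) :
    complexify K f x = f x := rfl

lemma ext_complexify {K : Type*} [TopologicalSpace K] {φ ψ : C(K, ℂ) →L[ℂ] ℂ}
    (h : ∀ g : C(K, ℝ), φ (complexify K g) = ψ (complexify K g)) : φ = ψ := by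
  ext f
  have hf : f = complexify K (Complex.reCLM.compLeftContinuous ℝ K f) +
      Complex.I • complexify K (Complex.imCLM.compLeftContinuous ℝ K f) := by
    ext x
    exact ((Complex.re_add_im (f x)).symm).trans (congrArg _ (mul_comm _ _))
  rw [hf, map_add, map_add, map_smul, map_smul, h, h]

lemma pairing_withDensityᵥ_const_complexify (ν : Measure K) [IsFiniteMeasure ν] (c : ℂ)
    (g : C(K, ℝ)) :
    pairing (ν.withDensityᵥ fun _ => c) (complexify K g) = c * (∫ x, g x ∂ν : ℝ) := by
  rw [pairing, integral_withDensityᵥ_const ν c (integrable_continuousMap ν _)]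
  exact congrArg (c * ·) integral_complex_ofReal

end ComplexMeasures

section Regularity

variable {K : Type*} [TopologicalSpace K] [MeasurableSpace K]

lemma regular_of_le [R1Space K] [BorelSpace K] {μ ν : Measure K} [ν.Regular] [IsFiniteMeasure ν]
    (h : μ ≤ ν) : μ.Regular := by
  have : IsFiniteMeasure μ := isFiniteMeasure_of_le ν h
  have : μ.InnerRegularCompactLTTop := by
    refine ⟨fun A ⟨hA, _⟩ r hr => ?_⟩
    obtain ⟨F, hFA, hF, hF_closed, hAF_lt⟩ := hA.exists_isCompact_isClosed_sdiff_lt (μ := ν)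
      (measure_ne_top ν A) (tsub_pos_of_lt hr).ne'
    refine ⟨F, hFA, hF, ?_⟩
    have hA_eq : μ A = μ F + μ (A \ F) := by
      rw [← measure_inter_add_sdiff A hF_closed.measurableSet, Set.inter_eq_right.2 hFA]
    have hAF : μ (A \ F) < μ A - r := (h _).trans_lt hAF_lt
    rw [lt_tsub_iff_right, hA_eq, add_comm] at hAF
    exact lt_of_add_lt_add_right hAF
  infer_instance

lemma isRegularMeasure_withDensityᵥ_const (ν : Measure K) [ν.Regular] [IsFiniteMeasure ν] (c : ℂ) :
    IsRegularMeasure (ν.withDensityᵥ fun _ => c) := by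
  rw [IsRegularMeasure, variation_withDensityᵥ_const]
  exact Measure.Regular.smul enorm_ne_top

variable [CompactSpace K] [T2Space K] [BorelSpace K]

lemma IsRegularMeasure.add {μ ν : ComplexMeasure K} (hμ : IsRegularMeasure μ)
    (hν : IsRegularMeasure ν) : IsRegularMeasure (μ + ν) := by
  have := hμ.isFiniteMeasure_variation
  have := hν.isFiniteMeasure_variation
  have : μ.variation.Regular := hμ
  have : ν.variation.Regular := hν
  exact regular_of_le (VectorMeasure.variation_add_le (μ := μ) (ν := ν))

theorem exists_isRegularMeasure_eq_pairing (ψ : C(K, ℂ) →L[ℂ] ℂ) :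
    ∃ μ : ComplexMeasure K, IsRegularMeasure μ ∧ ∀ f, ψ f = pairing μ f := by
  obtain ⟨a₁, a₂, _, _, _, _, ha⟩ := exists_measures_of_real_functional
    (Complex.reCLM ∘L ψ.restrictScalars ℝ ∘L complexify K)
  obtain ⟨b₁, b₂, _, _, _, _, hb⟩ := exists_measures_of_real_functional
    (Complex.imCLM ∘L ψ.restrictScalars ℝ ∘L complexify K)
  let m (ν : Measure K) (c : ℂ) : ComplexMeasure K := ν.withDensityᵥ fun _ => c
  have hm (ν : Measure K) [ν.Regular] [IsFiniteMeasure ν] (c : ℂ) : IsRegularMeasure (m ν c) :=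
    isRegularMeasure_withDensityᵥ_const ν c
  have ha_reg := (hm a₁ 1).add (hm a₂ (-1))
  have hb_reg := (hm b₁ Complex.I).add (hm b₂ (-Complex.I))
  have hμ := ha_reg.add hb_reg
  refine ⟨_, hμ, DFunLike.congr_fun (f := ψ) (g := pairingCLM _ hμ) (ext_complexify fun g => ?_)⟩
  have hre : (ψ (complexify K g)).re = ∫ x, g x ∂a₁ - ∫ x, g x ∂a₂ := ha g
  have him : (ψ (complexify K g)).im = ∫ x, g x ∂b₁ - ∫ x, g x ∂b₂ := hb g
  rw [pairingCLM_apply, pairing_add_measure ha_reg hb_reg,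
    pairing_add_measure (hm _ _) (hm _ _), pairing_add_measure (hm _ _) (hm _ _)]
  simp only [m, pairing_withDensityᵥ_const_complexify]
  rw [← Complex.re_add_im (ψ (complexify K g)), hre, him]
  push_cast
  ring

end Regularity

/-! ### Characters of a compact abelian group -/

section TestFunctions

variable {K : Type*} [TopologicalSpace K] [CompactSpace K] [MeasurableSpace K] [BorelSpace K]
  (ν : Measure K) [IsFiniteMeasure ν] [ν.IsOpenPosMeasure]

lemma eq_zero_of_forall_integral_smul_eq_zero {E : Type*} [NormedAddCommGroup E] [NormedSpace ℂ E]
    [CompleteSpace E] {F : K → E} (hF : Continuous F)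
    (h : ∀ f : C(K, ℂ), ∫ x, f x • F x ∂ν = 0) : F = 0 := by
  ext x
  refine SeparatingDual.eq_zero_of_forall_dual_eq_zero (R := ℂ) fun φ => ?_
  let c : C(K, ℂ) := ⟨fun x => φ (F x), φ.continuous.comp hF⟩
  have hint : Integrable (fun x => star (c x) • F x) ν :=
    (c.continuous.star.smul hF).integrable_of_hasCompactSupport
      (HasCompactSupport.of_compactSpace _)
  have hself : inner ℂ (ContinuousMap.toLp 2 ν ℂ c) (ContinuousMap.toLp 2 ν ℂ c) = 0 := by
    calc inner ℂ (ContinuousMap.toLp 2 ν ℂ c) (ContinuousMap.toLp 2 ν ℂ c)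
        = ∫ x, c x * conj (c x) ∂ν := ContinuousMap.inner_toLp ν c c
      _ = ∫ x, φ (star (c x) • F x) ∂ν := by
        simp only [map_smul, smul_eq_mul, mul_comm]
        rfl
      _ = φ (∫ x, (star c) x • F x ∂ν) := φ.integral_comp_comm hint
      _ = 0 := by rw [h, map_zero]
  have hc : c = 0 := ContinuousMap.toLp_injective ν (by rw [inner_self_eq_zero.1 hself, map_zero])
  exact congrArg (· x) hc

end TestFunctions

section Haar

variable {G : Type*} [CommGroup G] [TopologicalSpace G] [IsTopologicalGroup G] [CompactSpace G]
  [MeasurableSpace G] [BorelSpace G]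

instance : (normalizedHaar G).IsHaarMeasure := by
  unfold normalizedHaar
  infer_instance

instance : (normalizedHaar G).Regular := by
  unfold normalizedHaar
  infer_instance

variable (G) in
/-- The Hilbert space `L²(G)`. -/
abbrev HaarL2 : Type _ := Lp ℂ 2 (normalizedHaar G)

/-- Translation by `s` as an isometry of `L²(G)`. -/
noncomputable def translationIsometry (s : G) : HaarL2 G →ₗᵢ[ℂ] HaarL2 G where
  toFun F := DomMulAct.mk s • F
  map_add' := DomMulAct.smul_Lp_add _
  map_smul' c F := smul_comm _ c F
  norm_map' := DomMulAct.norm_smul_Lp _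

/-- The regular representation of `G` on `L²(G)`, by bounded operators. -/
noncomputable def translation : G →* (HaarL2 G →L[ℂ] HaarL2 G) where
  toFun s := (translationIsometry s).toContinuousLinearMap
  map_one' := ContinuousLinearMap.ext fun F => by
    change DomMulAct.mk (1 : G) • F = F
    rw [DomMulAct.mk_one, one_smul]
  map_mul' s t := ContinuousLinearMap.ext fun F => by
    change DomMulAct.mk (s * t) • F = DomMulAct.mk s • DomMulAct.mk t • F
    rw [smul_smul, ← DomMulAct.mk_mul, mul_comm]

lemma translation_apply (s : G) (F : HaarL2 G) : translation s F = DomMulAct.mk s • F := rfl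

@[simp]
lemma norm_translation_apply (s : G) (F : HaarL2 G) : ‖translation s F‖ = ‖F‖ :=
  (translationIsometry s).norm_map F

lemma star_translation (s : G) : star (translation s) = translation s⁻¹ := by
  rw [ContinuousLinearMap.star_eq_adjoint]
  refine ((ContinuousLinearMap.eq_adjoint_iff _ _).2 fun F H => ?_).symm
  calc inner ℂ (translation s⁻¹ F) H
      = inner ℂ (translation s (translation s⁻¹ F)) (translation s H) :=
        ((translationIsometry s).inner_map_map (translation s⁻¹ F) H).symm
    _ = inner ℂ F (translation s H) := by
        rw [← mul_apply_eq_comp, ← map_mul, mul_inv_cancel, map_one, one_apply_eq_self]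

lemma continuous_translation_apply (F : HaarL2 G) : Continuous fun s : G => translation s F := by
  have : Fact ((2 : ENNReal) ≠ ⊤) := ⟨ENNReal.ofNat_ne_top⟩
  exact DomMulAct.continuous_mk.smul continuous_const

lemma integrable_smul_translation (f : C(G, ℂ)) (F : HaarL2 G) :
    Integrable (fun s => f s • translation s F) (normalizedHaar G) :=
  (f.continuous.smul (continuous_translation_apply F)).integrable_of_hasCompactSupport
    (HasCompactSupport.of_compactSpace _)

lemma norm_integral_smul_translation_le (f : C(G, ℂ)) (F : HaarL2 G) :
    ‖∫ s, f s • translation s F ∂(normalizedHaar G)‖ ≤ ‖f‖ * ‖F‖ := by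
  refine (norm_integral_le_of_norm_le_const (C := ‖f‖ * ‖F‖)
    (Filter.Eventually.of_forall fun s => ?_)).trans (by simp)
  rw [norm_smul, norm_translation_apply]
  gcongr
  exact f.norm_coe_le_norm s

/-- The operator `∫ f(s) V(s) ds` on `L²(G)`, where `V` is the regular representation. -/
noncomputable def integratedTranslation (f : C(G, ℂ)) : HaarL2 G →L[ℂ] HaarL2 G :=
  LinearMap.mkContinuous
    { toFun := fun F => ∫ s, f s • translation s F ∂(normalizedHaar G)
      map_add' := fun F H => by
        simp only [map_add, smul_add]
        exact integral_add (integrable_smul_translation f F) (integrable_smul_translation f H)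
      map_smul' := fun c F => by
        simp only [map_smul, smul_comm _ c, integral_smul, RingHom.id_apply] }
    ‖f‖ (norm_integral_smul_translation_le f)

lemma integratedTranslation_apply (f : C(G, ℂ)) (F : HaarL2 G) :
    integratedTranslation f F = ∫ s, f s • translation s F ∂(normalizedHaar G) := rfl

lemma norm_integratedTranslation_le (f : C(G, ℂ)) : ‖integratedTranslation f‖ ≤ ‖f‖ :=
  LinearMap.mkContinuous_norm_le _ (norm_nonneg f) _

lemma integratedTranslation_sub (f g : C(G, ℂ)) :
    integratedTranslation (f - g) = integratedTranslation f - integratedTranslation g := by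
  ext1 F
  simp only [sub_apply, integratedTranslation_apply, ContinuousMap.sub_apply, sub_smul]
  exact integral_sub (integrable_smul_translation f F) (integrable_smul_translation g F)

lemma continuous_integratedTranslation :
    Continuous (integratedTranslation : C(G, ℂ) → (HaarL2 G →L[ℂ] HaarL2 G)) := by
  refine LipschitzWith.continuous (K := 1) (LipschitzWith.of_dist_le_mul fun f g => ?_)
  rw [dist_eq_norm, dist_eq_norm, ← integratedTranslation_sub, NNReal.coe_one, one_mul]
  exact norm_integratedTranslation_le _

lemma mul_integratedTranslation_apply (A : HaarL2 G →L[ℂ] HaarL2 G) (f : C(G, ℂ)) (F : HaarL2 G) :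
    (A * integratedTranslation f) F = ∫ s, f s • A (translation s F) ∂(normalizedHaar G) := by
  rw [mul_apply_eq_comp, integratedTranslation_apply,
    ← ContinuousLinearMap.integral_comp_comm _ (integrable_smul_translation f F)]
  simp only [map_smul]

lemma commute_integratedTranslation {A : HaarL2 G →L[ℂ] HaarL2 G}
    (hA : ∀ s, Commute (translation s) A) (f : C(G, ℂ)) : Commute (integratedTranslation f) A := by
  refine ContinuousLinearMap.ext fun F => ?_
  rw [mul_integratedTranslation_apply, mul_apply_eq_comp, integratedTranslation_apply]
  simp only [← mul_apply_eq_comp, (hA _).eq]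

end Haar

section Translate

variable {G : Type*} [Group G] [TopologicalSpace G] [ContinuousMul G]

/-- The translate `x ↦ f (t * x)` of a continuous function. -/
noncomputable def translate (f : C(G, ℂ)) (t : G) : C(G, ℂ) := f.comp (ContinuousMap.mulLeft t)

@[simp]
lemma translate_apply (f : C(G, ℂ)) (t x : G) : translate f t x = f (t * x) := rfl

lemma continuous_translate (f : C(G, ℂ)) : Continuous (translate f) :=
  (f.comp (⟨fun p : G × G => p.1 * p.2, continuous_mul⟩ : C(G × G, G))).curry.continuous

lemma norm_translate_le [CompactSpace G] (f : C(G, ℂ)) (t : G) :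
    ‖translate f t‖ ≤ ‖f‖ :=
  (ContinuousMap.norm_le _ (norm_nonneg f)).2 fun s => f.norm_coe_le_norm (t * s)

end Translate

section Separation

variable {G : Type*} [CommGroup G] [TopologicalSpace G] [IsTopologicalGroup G] [CompactSpace G]
  [MeasurableSpace G] [BorelSpace G]

lemma translation_mul_integratedTranslation (t : G) (f : C(G, ℂ)) :
    translation t * integratedTranslation f = integratedTranslation (translate f t⁻¹) := by
  ext1 F
  rw [mul_integratedTranslation_apply, integratedTranslation_apply,
    ← integral_mul_left_eq_self (fun s => translate f t⁻¹ s • translation s F) t]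
  simp only [translate_apply, inv_mul_cancel_left, map_mul, mul_apply_eq_comp]

lemma continuous_translation_mul_integratedTranslation (f : C(G, ℂ)) :
    Continuous fun t : G => translation t * integratedTranslation f := by
  simp only [translation_mul_integratedTranslation]
  exact continuous_integratedTranslation.comp ((continuous_translate f).comp continuous_inv)

lemma translation_injective [T2Space G] :
    Function.Injective (translation : G →* (HaarL2 G →L[ℂ] HaarL2 G)) := by
  refine (injective_iff_map_eq_one _).2 fun g hg => ?_
  by_contra hne
  obtain ⟨h, h0, h1, -⟩ := exists_continuous_zero_one_of_isClosed (isClosed_singleton (x := g))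
    (isClosed_singleton (x := (1 : G))) (by simpa using hne)
  have hc : Continuous fun x => (h x : ℂ) := Complex.continuous_ofReal.comp h.continuous
  have hcg : Continuous fun x : G => (h (g • x) : ℂ) := hc.comp (continuous_const_smul g)
  have hm : MemLp (fun x => (h x : ℂ)) 2 (normalizedHaar G) :=
    hc.memLp_of_hasCompactSupport (HasCompactSupport.of_compactSpace _)
  have hfix : translation g (hm.toLp _) = hm.toLp _ := by rw [hg, one_apply_eq_self]
  rw [translation_apply, DomMulAct.mk_smul_toLp, MemLp.toLp_eq_toLp_iff] at hfix
  have hval : (h (g • 1) : ℂ) = h 1 := congrFun ((hcg.ae_eq_iff_eq _ hc).1 hfix) 1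
  have hg0 : h g = 0 := h0 rfl
  have h11 : h 1 = 1 := h1 rfl
  simp [hg0, h11] at hval

lemma eq_one_of_forall_mul_integratedTranslation_eq {A : HaarL2 G →L[ℂ] HaarL2 G}
    (hA : ∀ f : C(G, ℂ), A * integratedTranslation f = integratedTranslation f) : A = 1 := by
  ext1 F
  let D (s : G) : HaarL2 G := (A - 1) (translation s F)
  have hD : D = 0 := by
    refine eq_zero_of_forall_integral_smul_eq_zero (normalizedHaar G)
      ((A - 1).continuous.comp (continuous_translation_apply F)) fun f => ?_
    change ∫ s, f s • (A - 1) (translation s F) ∂(normalizedHaar G) = 0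
    rw [← mul_integratedTranslation_apply, sub_mul, hA, one_mul, sub_self, zero_apply]
  have h1 : D 1 = 0 := congrFun hD 1
  rwa [show D 1 = (A - 1) F by simp [D], sub_apply, sub_eq_zero] at h1

variable (G) in
/-- The von Neumann algebra generated by the translations of `L²(G)`, as their bicommutant. -/
noncomputable def translationAlgebra : StarSubalgebra ℂ (HaarL2 G →L[ℂ] HaarL2 G) :=
  StarSubalgebra.centralizer ℂ
    (StarSubalgebra.centralizer ℂ (Set.range (translation (G := G))) : Set _)

lemma mem_translationAlgebra_iff {A : HaarL2 G →L[ℂ] HaarL2 G} :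
    A ∈ translationAlgebra G ↔
      ∀ B : HaarL2 G →L[ℂ] HaarL2 G, (∀ s, Commute (translation s) B) → Commute B A := by
  have hstar : star (Set.range (translation (G := G))) ⊆ Set.range (translation (G := G)) := by
    rintro A ⟨s, hs⟩
    exact ⟨s⁻¹, by rw [← star_translation, hs, star_star]⟩
  rw [← SetLike.mem_coe, translationAlgebra, StarSubalgebra.coe_centralizer_centralizer,
    Set.union_eq_self_of_subset_right hstar, Set.mem_centralizer_iff]
  simp only [Set.mem_centralizer_iff, Set.forall_mem_range]
  rfl

instance : IsClosed (translationAlgebra G : Set (HaarL2 G →L[ℂ] HaarL2 G)) :=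
  Set.isClosed_centralizer _

lemma translation_mem (s : G) : translation s ∈ translationAlgebra G :=
  mem_translationAlgebra_iff.2 fun _ hB => (hB s).symm

lemma integratedTranslation_mem (f : C(G, ℂ)) : integratedTranslation f ∈ translationAlgebra G :=
  mem_translationAlgebra_iff.2 fun _ hB => (commute_integratedTranslation hB f).symm

lemma translationAlgebra_comm (A B : translationAlgebra G) : A * B = B * A :=
  Subtype.ext (mem_translationAlgebra_iff.1 B.2 A fun s =>
    mem_translationAlgebra_iff.1 A.2 _ fun t => (Commute.all t s).map translation)

noncomputable instance : CommCStarAlgebra (translationAlgebra G) :=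
  { StarSubalgebra.cstarAlgebra (translationAlgebra G) with
    mul_comm := translationAlgebra_comm }

variable (G) in
/-- The regular representation of `G`, with values in the von Neumann algebra it generates. -/
noncomputable def algebraTranslation : G →* translationAlgebra G where
  toFun s := ⟨translation s, translation_mem s⟩
  map_one' := Subtype.ext (map_one translation)
  map_mul' s t := Subtype.ext (map_mul translation s t)

open WeakDual

lemma exists_characterSpace_apply_ne_zero {A : Type*} [CommCStarAlgebra A] {a : A} (ha : a ≠ 0) :
    ∃ χ : characterSpace ℂ A, χ a ≠ 0 := by
  by_contra! h
  refine ha ((gelfandTransform_isometry A).injective ?_)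
  ext χ
  rw [map_zero]
  exact h χ

lemma exists_pontryaginDual_coe_eq {H : Type*} [CommGroup H] [TopologicalSpace H] (v : H →* ℂ)
    (hv : Continuous v) (hnorm : ∀ s, ‖v s‖ = 1) : ∃ γ : PontryaginDual H, ∀ s, (γ s : ℂ) = v s :=
  ⟨{ toFun := fun s => ⟨v s, mem_sphere_zero_iff_norm.2 (hnorm s)⟩
     map_one' := Subtype.ext (map_one v)
     map_mul' := fun s t => Subtype.ext (map_mul v s t)
     continuous_toFun := hv.subtype_mk _ }, fun _ => rfl⟩

lemma norm_characterSpace_algebraTranslation (χ : characterSpace ℂ (translationAlgebra G)) (s : G) :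
    ‖χ (algebraTranslation G s)‖ = 1 := by
  have hstar : star (algebraTranslation G s) * algebraTranslation G s = 1 := by
    rw [show star (algebraTranslation G s) = algebraTranslation G s⁻¹ from
      Subtype.ext (star_translation s), ← map_mul, inv_mul_cancel, map_one]
  have hsq := congrArg (fun a => ‖χ a‖) hstar
  simp only [map_mul, map_star, map_one, norm_mul, norm_star, norm_one] at hsq
  nlinarith [norm_nonneg (χ (algebraTranslation G s))]

/-- The regular representation is only strongly continuous, but it becomes norm continuous after
multiplication by `integratedTranslation f`. -/
lemma continuous_characterSpace_algebraTranslation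
    (χ : characterSpace ℂ (translationAlgebra G)) (f : C(G, ℂ))
    (hf : χ ⟨integratedTranslation f, integratedTranslation_mem f⟩ ≠ 0) :
    Continuous fun s => χ (algebraTranslation G s) := by
  let T : translationAlgebra G := ⟨integratedTranslation f, integratedTranslation_mem f⟩
  have hVT : Continuous fun s => algebraTranslation G s * T :=
    (continuous_translation_mul_integratedTranslation f).subtype_mk _
  have hdiv : (fun s => χ (algebraTranslation G s)) =
      fun s => χ (algebraTranslation G s * T) * (χ T)⁻¹ := by
    ext s
    rw [map_mul, mul_inv_cancel_right₀ hf]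
  rw [hdiv]
  exact ((map_continuous χ).comp hVT).mul continuous_const

theorem exists_pontryaginDual_apply_ne_one [T2Space G] {g : G} (hg : g ≠ 1) :
    ∃ γ : PontryaginDual G, γ g ≠ 1 := by
  obtain ⟨f, hf⟩ : ∃ f : C(G, ℂ),
      translation g * integratedTranslation f ≠ integratedTranslation f := by
    by_contra! hall
    exact hg (translation_injective
      ((eq_one_of_forall_mul_integratedTranslation_eq hall).trans (map_one translation).symm))
  let T : translationAlgebra G := ⟨integratedTranslation f, integratedTranslation_mem f⟩
  have hVT : algebraTranslation G g * T - T ≠ 0 :=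
    fun h => hf (congrArg Subtype.val (sub_eq_zero.1 h))
  obtain ⟨χ, hχ⟩ := exists_characterSpace_apply_ne_zero hVT
  let v : G →* ℂ := MonoidHom.comp (χ : translationAlgebra G →* ℂ) (algebraTranslation G)
  have hne : v g * χ T - χ T ≠ 0 := by
    rw [map_sub, map_mul] at hχ
    exact hχ
  have hT : χ T ≠ 0 := fun h => hne (by rw [h, mul_zero, sub_zero])
  obtain ⟨γ, hγ⟩ := exists_pontryaginDual_coe_eq v
    (continuous_characterSpace_algebraTranslation χ f hT)
    (norm_characterSpace_algebraTranslation χ)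
  refine ⟨γ, fun h => hne ?_⟩
  rw [← hγ, h, Circle.coe_one, one_mul, sub_self]

end Separation

section Fourier

/-- The continuous characters of `G`, viewed as elements of `C(G, ℂ)`. -/
noncomputable def character (G : Type*) [CommGroup G] [TopologicalSpace G] :
    PontryaginDual G →* C(G, ℂ) where
  toFun γ := ⟨fun x => (γ x : ℂ), continuous_subtype_val.comp (map_continuous γ)⟩
  map_one' := rfl
  map_mul' _ _ := rfl

section Character

variable {G : Type*} [CommGroup G] [TopologicalSpace G]

@[simp]
lemma character_apply (γ : PontryaginDual G) (x : G) : character G γ x = (γ x : ℂ) := rfl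

lemma character_inv (γ : PontryaginDual G) : character G γ⁻¹ = star (character G γ) :=
  ContinuousMap.ext fun x => Circle.coe_inv_eq_conj (γ x)

lemma adjoin_range_character [CompactSpace G] :
    Subalgebra.toSubmodule (StarAlgebra.adjoin ℂ (Set.range (character G))).toSubalgebra =
      Submodule.span ℂ (Set.range (character G)) := by
  have hstar : star (Set.range (character G)) ⊆ Set.range (character G) := by
    rintro f ⟨γ, hγ⟩
    exact ⟨γ⁻¹, by rw [character_inv, hγ, star_star]⟩
  rw [StarAlgebra.adjoin_eq_span, Set.union_eq_self_of_subset_right hstar, ← MonoidHom.coe_mrange,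
    Submonoid.closure_eq]

end Character

variable {G : Type*} [CommGroup G] [TopologicalSpace G] [IsTopologicalGroup G] [CompactSpace G]
  [MeasurableSpace G] [BorelSpace G]

lemma dense_span_range_character [T2Space G] :
    Dense (Submodule.span ℂ (Set.range (character G)) : Set C(G, ℂ)) := by
  have htop : (StarAlgebra.adjoin ℂ (Set.range (character G))).topologicalClosure = ⊤ := by
    refine ContinuousMap.starSubalgebra_topologicalClosure_eq_top_of_separatesPoints _ ?_
    intro x y hxy
    obtain ⟨γ, hγ⟩ := exists_pontryaginDual_apply_ne_one (g := x * y⁻¹)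
      (by rwa [ne_eq, mul_inv_eq_one])
    refine ⟨_, ⟨character G γ, StarAlgebra.subset_adjoin ℂ _ ⟨γ, rfl⟩, rfl⟩, fun h => hγ ?_⟩
    rw [map_mul, map_inv, mul_inv_eq_one]
    exact Subtype.ext h
  rw [← adjoin_range_character, dense_iff_closure_eq]
  exact (StarSubalgebra.topologicalClosure_coe _).symm.trans (congrArg _ htop)

lemma inner_toLp_character (γ : PontryaginDual G) (f : C(G, ℂ)) :
    inner ℂ (ContinuousMap.toLp 2 (normalizedHaar G) ℂ (character G γ))
      (ContinuousMap.toLp 2 (normalizedHaar G) ℂ f) = fourierCoefficient f γ := by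
  rw [ContinuousMap.inner_toLp, fourierCoefficient]
  congr 1 with x
  exact mul_comm _ _

theorem eq_zero_of_fourierCoefficient_eq_zero [T2Space G] {f : C(G, ℂ)}
    (hf : ∀ γ, fourierCoefficient f γ = 0) : f = 0 := by
  let J := ContinuousMap.toLp (E := ℂ) 2 (normalizedHaar G) ℂ
  have hspan : ∀ p ∈ Submodule.span ℂ (Set.range (character G)), inner ℂ (J f) (J p) = 0 := by
    have hle : Submodule.span ℂ (Set.range (character G)) ≤
        LinearMap.ker ((innerSL ℂ (J f)).comp J).toLinearMap := by
      refine Submodule.span_le.2 ?_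
      rintro _ ⟨γ, rfl⟩
      exact inner_eq_zero_symm.1 ((inner_toLp_character γ f).trans (hf γ))
    exact fun p hp => hle hp
  have hself : inner ℂ (J f) (J f) = 0 :=
    congrFun (Continuous.ext_on dense_span_range_character
      (continuous_const.inner J.continuous) continuous_const hspan) f
  exact ContinuousMap.toLp_injective (normalizedHaar G) (by
    rw [inner_self_eq_zero.1 hself, map_zero])

lemma fourierCoefficient_translate (f : C(G, ℂ)) (t : G) (γ : PontryaginDual G) :
    fourierCoefficient (translate f t) γ = (γ t : ℂ) * fourierCoefficient f γ := by
  rw [fourierCoefficient, fourierCoefficient, ← integral_const_mul,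
    ← integral_mul_left_eq_self (fun x => (γ t : ℂ) * (conj (γ x : ℂ) * f x)) t]
  congr 1 with x
  have hunit : (γ t : ℂ) * conj (γ t : ℂ) = 1 := by
    rw [Complex.mul_conj, Circle.normSq_coe, Complex.ofReal_one]
  simp only [translate_apply, map_mul, Circle.coe_mul]
  linear_combination (-(conj (γ x : ℂ)) * f (t * x)) * hunit

lemma translate_mem_continuousWithSpec {Λ : Set (PontryaginDual G)} {f : C(G, ℂ)}
    (hf : f ∈ continuousWithSpec Λ) (t : G) : translate f t ∈ continuousWithSpec Λ := by
  refine fun γ hγ => hf fun h => hγ ?_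
  rw [fourierCoefficient_translate, h, mul_zero]

lemma integrable_smul_translate (f g : C(G, ℂ)) :
    Integrable (fun t => g t • translate f t) (normalizedHaar G) :=
  (g.continuous.smul (continuous_translate f)).integrable_of_hasCompactSupport
    (HasCompactSupport.of_compactSpace _)

lemma integral_character_smul_translate (f : C(G, ℂ)) (γ : PontryaginDual G) :
    ∫ t, star (character G γ) t • translate f t ∂(normalizedHaar G) =
      fourierCoefficient f γ • character G γ := by
  ext x
  rw [ContinuousMap.integral_apply (integrable_smul_translate f _), ContinuousMap.smul_apply,
    smul_eq_mul, mul_comm, character_apply, ← fourierCoefficient_translate]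
  congr 1 with t
  rw [ContinuousMap.smul_apply, translate_apply, translate_apply, mul_comm t x]
  rfl

/-- Every Fourier coefficient of `t ↦ ψ (translate f t)` vanishes. -/
theorem apply_eq_zero_of_mem_continuousWithSpec [T2Space G] {Λ : Set (PontryaginDual G)}
    (ψ : C(G, ℂ) →L[ℂ] ℂ) (hψ : ∀ γ ∈ Λ, ψ (character G γ) = 0) {f : C(G, ℂ)}
    (hf : f ∈ continuousWithSpec Λ) : ψ f = 0 := by
  let h : C(G, ℂ) := ⟨fun t => ψ (translate f t), ψ.continuous.comp (continuous_translate f)⟩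
  have hcoeff (γ : PontryaginDual G) :
      fourierCoefficient h γ = fourierCoefficient f γ * ψ (character G γ) := by
    calc fourierCoefficient h γ
        = ∫ t, ψ (star (character G γ) t • translate f t) ∂(normalizedHaar G) := by
          simp only [map_smul]
          rfl
      _ = ψ (∫ t, star (character G γ) t • translate f t ∂(normalizedHaar G)) :=
          ψ.integral_comp_comm (integrable_smul_translate f _)
      _ = fourierCoefficient f γ * ψ (character G γ) := by
          rw [integral_character_smul_translate, map_smul, smul_eq_mul]
  have hzero : h = 0 := eq_zero_of_fourierCoefficient_eq_zero fun γ => by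
    rw [hcoeff, mul_eq_zero, or_iff_not_imp_left]
    exact fun hγ => hψ γ (hf hγ)
  have htranslate : translate f 1 = f := ContinuousMap.ext fun x => by
    rw [translate_apply, one_mul]
  rw [← htranslate]
  exact congrArg (fun k : C(G, ℂ) => k 1) hzero

end Fourier

/-! ### Narrow operators on spaces of continuous functions -/

section Narrow

variable {X E : Type*} [NormedAddCommGroup X] [NormedSpace ℂ X] [SeminormedAddCommGroup E]
  [NormedSpace ℂ E]

lemma norm_sub_inv_norm_smul {z : X} (hz : z ≠ 0) :
    ‖z - ((‖z‖⁻¹ : ℝ) : ℂ) • z‖ = |‖z‖ - 1| := by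
  have hfactor : z - ((‖z‖⁻¹ : ℝ) : ℂ) • z = ((1 - ‖z‖⁻¹ : ℝ) : ℂ) • z := by
    rw [Complex.ofReal_sub, Complex.ofReal_one, sub_smul, one_smul]
  rw [hfactor, norm_smul, Complex.norm_real, Real.norm_eq_abs]
  nth_rewrite 2 [← abs_of_nonneg (norm_nonneg z)]
  rw [← abs_mul, sub_mul, one_mul, inv_mul_cancel₀ (norm_ne_zero_iff.2 hz)]

lemma norm_map_sub_le {S : X →L[ℂ] E} {y z₀ z : X} {a b : ℝ} (hy : ‖S (y - z₀)‖ ≤ a)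
    (hz : ‖z₀ - z‖ ≤ b) : ‖S (y - z)‖ ≤ a + ‖S‖ * b := by
  rw [← sub_add_sub_cancel y z₀ z, map_add]
  exact (norm_add_le _ _).trans (add_le_add hy (S.le_of_opNorm_le_of_le le_rfl hz))

lemma norm_map_smul_le {S : X →L[ℂ] E} {c : ℂ} {x : X} {a b : ℝ} (hc : ‖c‖ ≤ a)
    (hx : ‖S x‖ ≤ b) : ‖S (c • x)‖ ≤ a * b := by
  rw [map_smul, norm_smul]
  exact mul_le_mul hc hx (norm_nonneg _) ((norm_nonneg c).trans hc)

lemma isNarrow_of_forall_exists {T : X →L[ℂ] E}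
    (h : ∀ x y : X, ‖x‖ = 1 → ‖y‖ = 1 → ∀ φ : X →L[ℂ] ℂ, ∀ δ > 0, ∃ z : X,
      ‖z‖ ≤ 1 + δ ∧ ‖T (y - z)‖ ≤ δ ∧ ‖φ (y - z)‖ ≤ δ ∧ 2 - δ ≤ ‖x + z‖) : IsNarrow T := by
  intro x hx y hy φ ε hε
  rw [mem_sphere_zero_iff_norm] at hx hy
  let C : ℝ := 2 + ‖T‖ + ‖φ‖
  have hC : 2 ≤ C := by simp only [C]; linarith [norm_nonneg T, norm_nonneg φ]
  have hC0 : 0 < C := two_pos.trans_le hC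
  let δ : ℝ := min (1 / 4) (ε / C)
  have hδ : 0 < δ := by positivity
  have hδC : C * δ ≤ ε := (mul_le_mul_of_nonneg_left (min_le_right _ _) hC0.le).trans_eq
    (mul_div_cancel₀ ε hC0.ne')
  obtain ⟨z₀, hz₀, hT, hφ, hxz⟩ := h x y hx hy φ δ hδ
  have hz₀' : 1 - δ ≤ ‖z₀‖ := by linarith [norm_add_le x z₀]
  have hpos : 0 < ‖z₀‖ := by linarith [min_le_left (1 / 4) (ε / C)]
  let z : X := ((‖z₀‖⁻¹ : ℝ) : ℂ) • z₀
  have hz : ‖z‖ = 1 := by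
    rw [norm_smul, Complex.norm_real, norm_inv, norm_norm, inv_mul_cancel₀ hpos.ne']
  have hclose : ‖z₀ - z‖ ≤ δ := by
    rw [norm_sub_inv_norm_smul (norm_pos_iff.1 hpos), abs_le]
    constructor <;> linarith
  refine ⟨z, mem_sphere_zero_iff_norm.2 hz, ?_, ?_⟩
  · calc ‖T (y - z)‖ + ‖φ (y - z)‖
        ≤ (δ + ‖T‖ * δ) + (δ + ‖φ‖ * δ) :=
          add_le_add (norm_map_sub_le hT hclose) (norm_map_sub_le hφ hclose)
      _ = C * δ := by simp only [C]; ring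
      _ ≤ ε := hδC
  · have hsum : ‖x + z₀‖ ≤ ‖x + z‖ + ‖z₀ - z‖ := by
      rw [← add_sub_add_left_eq_sub z₀ z x]
      exact norm_le_norm_add_norm_sub' _ _
    linarith [mul_le_mul_of_nonneg_right hC hδ.le]

end Narrow

lemma le_re_of_le_norm_ofReal_add {b : ℝ} (hb : b ∈ Set.Icc (0 : ℝ) 1) {z : ℂ} (hz : ‖z‖ ≤ 1)
    (h : 7 / 4 ≤ ‖(b : ℂ) + z‖) : 3 / 4 ≤ b ∧ 1 / 2 ≤ z.re := by
  constructor
  · have hsum := h.trans (norm_add_le _ _)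
    rw [Complex.norm_real, Real.norm_of_nonneg hb.1] at hsum
    linarith
  · have hexpand : ‖(b : ℂ) + z‖ ^ 2 = b ^ 2 + 2 * b * z.re + ‖z‖ ^ 2 := by
      rw [Complex.sq_norm, Complex.sq_norm, Complex.normSq_add, Complex.normSq_ofReal,
        Complex.re_ofReal_mul, Complex.conj_re]
      ring
    have hsq : (7 / 4 : ℝ) ^ 2 ≤ ‖(b : ℂ) + z‖ ^ 2 := by gcongr
    have hz2 : ‖z‖ ^ 2 ≤ 1 := pow_le_one₀ (norm_nonneg _) hz
    have hb2 : b ^ 2 ≤ 1 := pow_le_one₀ hb.1 hb.2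
    by_contra! hre
    nlinarith [hb.1, hb.2]

/-- The radial retraction of the complex plane onto the unit disc. -/
noncomputable def discRetraction (w : ℂ) : ℂ := w / (max 1 ‖w‖ : ℝ)

@[fun_prop]
lemma continuous_discRetraction : Continuous discRetraction := by
  refine continuous_id.div (by fun_prop) fun w => ?_
  exact_mod_cast (lt_max_of_lt_left one_pos : (0 : ℝ) < max 1 ‖w‖).ne'

lemma norm_discRetraction_le (w : ℂ) : ‖discRetraction w‖ ≤ 1 := by
  have h : (0 : ℝ) < max 1 ‖w‖ := lt_max_of_lt_left one_pos
  rw [discRetraction, norm_div, Complex.norm_real, Real.norm_of_nonneg h.le, div_le_one h]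
  exact le_max_right _ _

lemma discRetraction_of_norm_le {w : ℂ} (hw : ‖w‖ ≤ 1) : discRetraction w = w := by
  rw [discRetraction, max_eq_left hw, Complex.ofReal_one, div_one]

section Bump

variable {K : Type*} [TopologicalSpace K]

/-- The continuous functions from `K` to `[0, 1]` that peak at `t` and vanish off `U`. -/
def bumpFunctions (U : Set K) (t : K) : Set C(K, ℝ) :=
  {f | f t = 1 ∧ (∀ s ∉ U, f s = 0) ∧ ∀ s, f s ∈ Set.Icc (0 : ℝ) 1}

variable [CompactSpace K]

lemma exists_norm_apply_eq_norm [Nonempty K] (x : C(K, ℂ)) : ∃ t, ‖x t‖ = ‖x‖ := by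
  obtain ⟨t, -, ht⟩ := isCompact_univ.exists_isMaxOn Set.univ_nonempty
    x.continuous.norm.continuousOn
  exact ⟨t, le_antisymm (x.norm_coe_le_norm t)
    ((ContinuousMap.norm_le _ (norm_nonneg _)).2 fun s => ht (Set.mem_univ s))⟩

lemma norm_complexify_bump {U : Set K} {t : K} {b : C(K, ℝ)} (hb : b ∈ bumpFunctions U t) :
    ‖complexify K b‖ = 1 := by
  refine le_antisymm ((ContinuousMap.norm_le _ zero_le_one).2 fun s => ?_) ?_
  · rw [complexify_apply, Complex.norm_real, Real.norm_of_nonneg (hb.2.2 s).1]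
    exact (hb.2.2 s).2
  · have h := (complexify K b).norm_coe_le_norm t
    rwa [complexify_apply, hb.1, Complex.ofReal_one, norm_one] at h

lemma norm_one_sub_mul_apply_le {b : ℝ} (hb : b ≤ 1) {r : C(K, ℂ)} (hr : ‖r‖ ≤ 1) (s : K) :
    ‖((1 - b : ℝ) : ℂ) * r s‖ ≤ 1 - b := by
  rw [norm_mul, Complex.norm_real, Real.norm_of_nonneg (sub_nonneg.2 hb)]
  exact mul_le_of_le_one_right (sub_nonneg.2 hb) ((r.norm_coe_le_norm s).trans hr)

lemma norm_one_sub_bump_mul_sub_bump {U : Set K} {t : K} {b : C(K, ℝ)}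
    (hb : b ∈ bumpFunctions U t) {r : C(K, ℂ)} (hr : ‖r‖ ≤ 1) :
    ‖(1 - complexify K b) * r - complexify K b‖ = 1 := by
  refine le_antisymm ((ContinuousMap.norm_le _ zero_le_one).2 fun s => ?_) ?_
  · have htri := norm_sub_le (((1 - b s : ℝ) : ℂ) * r s) (b s)
    rw [Complex.norm_real, Real.norm_of_nonneg (hb.2.2 s).1] at htri
    have hval : ((1 - complexify K b) * r - complexify K b) s =
        ((1 - b s : ℝ) : ℂ) * r s - b s := by simp
    rw [hval]
    linarith [norm_one_sub_mul_apply_le (hb.2.2 s).2 hr s]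
  · have h := ((1 - complexify K b) * r - complexify K b).norm_coe_le_norm t
    simpa [hb.1] using h

variable {E : Type*} [SeminormedAddCommGroup E] [NormedSpace ℂ E] {T : C(K, ℂ) →L[ℂ] E}

lemma norm_add_smul_bump_le {x y : C(K, ℂ)} (hx : ‖x‖ ≤ 1) (hy : ‖y‖ ≤ 1) {U : Set K} {t t₀ : K}
    {δ : ℝ} (hyU : ∀ s ∈ U, ‖y s - y t₀‖ ≤ δ) (hδ : 0 ≤ δ) {f : C(K, ℝ)}
    (hf : f ∈ bumpFunctions U t) : ‖y + (x t₀ - y t₀) • complexify K f‖ ≤ 1 + δ := by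
  obtain ⟨-, hf0, hf01⟩ := hf
  refine (ContinuousMap.norm_le _ (by positivity)).2 fun s => ?_
  rw [ContinuousMap.add_apply, ContinuousMap.smul_apply, complexify_apply, smul_eq_mul]
  have hys : ‖y s‖ ≤ 1 := (y.norm_coe_le_norm s).trans hy
  by_cases hs : s ∈ U
  · have hconvex : y s + (x t₀ - y t₀) * (f s : ℂ) =
        ((1 - f s : ℝ) : ℂ) * y s + ((f s : ℝ) : ℂ) * (x t₀ + (y s - y t₀)) := by
      push_cast
      ring
    rw [hconvex]
    refine (norm_add_le _ _).trans ?_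
    rw [norm_mul, norm_mul, Complex.norm_real, Complex.norm_real,
      Real.norm_of_nonneg (sub_nonneg.2 (hf01 s).2), Real.norm_of_nonneg (hf01 s).1]
    have hnear : ‖x t₀ + (y s - y t₀)‖ ≤ 1 + δ :=
      (norm_add_le _ _).trans (add_le_add ((x.norm_coe_le_norm t₀).trans hx) (hyU s hs))
    nlinarith [(hf01 s).1, (hf01 s).2]
  · rw [hf0 s hs, Complex.ofReal_zero, mul_zero, add_zero]
    linarith

/-- Near a point `t₀` where `x` attains its norm, a bump that is almost killed by `T` and `φ`
changes the value `y t₀` to `x t₀`. -/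
lemma isNarrow_of_exists_bump [Nonempty K]
    (h : ∀ U : Set K, IsOpen U → U.Nonempty → ∀ φ : C(K, ℂ) →L[ℂ] ℂ, ∀ δ > 0,
      ∃ t ∈ U, ∃ f ∈ bumpFunctions U t, ‖T (complexify K f)‖ ≤ δ ∧ ‖φ (complexify K f)‖ ≤ δ) :
    IsNarrow T := by
  refine isNarrow_of_forall_exists fun x y hx hy φ δ hδ => ?_
  obtain ⟨t₀, ht₀⟩ := exists_norm_apply_eq_norm x
  let U : Set K := {s | ‖x s - x t₀‖ < δ / 2} ∩ {s | ‖y s - y t₀‖ < δ / 2}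
  have hU : IsOpen U :=
    (isOpen_lt (by fun_prop) continuous_const).inter (isOpen_lt (by fun_prop) continuous_const)
  obtain ⟨t, ⟨htx, hty⟩, f, hf, hTf, hφf⟩ := h U hU ⟨t₀, by simp [U, hδ]⟩ φ (δ / 2) (by positivity)
  have hc : ‖x t₀ - y t₀‖ ≤ 2 := by
    linarith [norm_sub_le (x t₀) (y t₀), y.norm_coe_le_norm t₀]
  refine ⟨y + (x t₀ - y t₀) • complexify K f, ?_, ?_, ?_, ?_⟩
  · have hnorm := norm_add_smul_bump_le (δ := δ / 2) hx.le hy.le (fun s hs => hs.2.le)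
      (by positivity) hf
    linarith
  · rw [sub_add_cancel_left, map_neg, norm_neg]
    linarith [norm_map_smul_le hc hTf]
  · rw [sub_add_cancel_left, map_neg, norm_neg]
    linarith [norm_map_smul_le hc hφf]
  · refine le_trans ?_ (ContinuousMap.norm_coe_le_norm _ t)
    have hval : (x + (y + (x t₀ - y t₀) • complexify K f)) t =
        2 * x t₀ + ((x t - x t₀) + (y t - y t₀)) := by
      simp only [ContinuousMap.add_apply, ContinuousMap.smul_apply, complexify_apply, hf.1,
        Complex.ofReal_one, smul_eq_mul]
      ring
    have htwo : ‖2 * x t₀‖ = 2 := by rw [norm_mul, ht₀, hx, Complex.norm_ofNat, mul_one]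
    rw [hval]
    have hlow := norm_sub_le_norm_add (2 * x t₀) ((x t - x t₀) + (y t - y t₀))
    have hxU : ‖x t - x t₀‖ < δ / 2 := htx
    have hyU : ‖y t - y t₀‖ < δ / 2 := hty
    linarith [norm_add_le (x t - x t₀) (y t - y t₀)]

variable [T2Space K]

lemma bumpFunctions_nonempty {U : Set K} (hU : IsOpen U) {t : K} (ht : t ∈ U) :
    (bumpFunctions U t).Nonempty := by
  obtain ⟨f, h0, h1, h⟩ := exists_continuous_zero_one_of_isClosed hU.isClosed_compl
    (isClosed_singleton (x := t)) (by simpa using ht)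
  exact ⟨f, h1 rfl, fun s hs => h0 hs, h⟩

/-- With a bump `b` in `U`, narrowness is applied to `x = b` and `y = (1 - b) r - b`, and
`d = z - y`. -/
lemma IsNarrow.exists_one_le_re (hT : IsNarrow T) {U : Set K} (hU : IsOpen U) (hne : U.Nonempty)
    {r : C(K, ℂ)} (hr : ‖r‖ ≤ 1) {η : ℝ} (hη : 0 < η) :
    ∃ d : C(K, ℂ), ‖d‖ ≤ 2 ∧ ‖T d‖ ≤ η ∧ (∃ t ∈ U, 1 ≤ (d t).re) ∧ ∀ s ∉ U, ‖r s + d s‖ ≤ 1 := by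
  obtain ⟨t, ht⟩ := hne
  have : Nonempty K := ⟨t⟩
  obtain ⟨b, hb⟩ := bumpFunctions_nonempty hU ht
  let x : C(K, ℂ) := complexify K b
  let y : C(K, ℂ) := (1 - x) * r - x
  have hy (s : K) : y s = ((1 - b s : ℝ) : ℂ) * r s - b s := by simp [x, y]
  have hyn : ‖y‖ = 1 := norm_one_sub_bump_mul_sub_bump hb hr
  obtain ⟨z, hz, hTz, hxz⟩ := hT x (mem_sphere_zero_iff_norm.2 (norm_complexify_bump hb)) y
    (mem_sphere_zero_iff_norm.2 hyn) 0 (min η (1 / 4)) (by positivity)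
  rw [mem_sphere_zero_iff_norm] at hz
  obtain ⟨t', ht'⟩ := exists_norm_apply_eq_norm (x + z)
  obtain ⟨hbt', hzt'⟩ := le_re_of_le_norm_ofReal_add (hb.2.2 t')
    ((z.norm_coe_le_norm t').trans hz.le) (by
      rw [← complexify_apply b t', ← ContinuousMap.add_apply, ht']
      linarith [min_le_right η (1 / 4)])
  refine ⟨z - y, ?_, ?_, ⟨t', ?_, ?_⟩, fun s hs => ?_⟩
  · linarith [norm_sub_le z y]
  · rw [zero_apply, norm_zero, add_zero] at hTz
    rw [← neg_sub, map_neg, norm_neg]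
    exact hTz.trans (min_le_left _ _)
  · by_contra ht'U
    linarith [hb.2.1 t' ht'U]
  · rw [ContinuousMap.sub_apply, hy, Complex.sub_re, Complex.sub_re, Complex.ofReal_re]
    linarith [(Complex.re_le_norm _).trans (norm_one_sub_mul_apply_le (hb.2.2 t').2 hr t')]
  · have hrd : r s + (z - y) s = z s := by
      simp [hy, hb.2.1 s hs]
    exact hrd ▸ (z.norm_coe_le_norm s).trans hz.le

/-- The new summand peaks where `S` is already almost as large as at `t`, so that the increments of
the maximum accumulate, whereas off `U` the bound by one is preserved. -/
lemma IsNarrow.exists_increment (hT : IsNarrow T) {U : Set K} (hU : IsOpen U) {S : C(K, ℂ)}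
    (hS : ∀ s ∉ U, ‖S s‖ ≤ 1) {t : K} (ht : t ∈ U) {η : ℝ} (hη : 0 < η) :
    ∃ S' : C(K, ℂ), ∃ t' ∈ U, (∀ s ∉ U, ‖S' s‖ ≤ 1) ∧ ‖S'‖ ≤ ‖S‖ + 2 ∧
      (S t).re + 1 / 2 ≤ (S' t').re ∧ ‖T S'‖ ≤ ‖T S‖ + η := by
  let V : Set K := U ∩ {s | (S t).re - 1 / 2 < (S s).re}
  have hV : IsOpen V := hU.inter (isOpen_lt continuous_const (by fun_prop))
  let r : C(K, ℂ) := ⟨fun s => discRetraction (S s), by fun_prop⟩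
  have hr : ‖r‖ ≤ 1 := (ContinuousMap.norm_le _ zero_le_one).2 fun s => norm_discRetraction_le _
  obtain ⟨d, hd, hTd, ⟨t', ht'V, ht'd⟩, hrd⟩ :=
    hT.exists_one_le_re hV ⟨t, ht, by simp⟩ hr hη
  refine ⟨S + d, t', ht'V.1, fun s hs => ?_, ?_, ?_, ?_⟩
  · have hrs : r s = S s := discRetraction_of_norm_le (hS s hs)
    rw [ContinuousMap.add_apply, ← hrs]
    exact hrd s fun h => hs h.1
  · exact (norm_add_le _ _).trans (by gcongr)
  · have hlarge : (S t).re - 1 / 2 < (S t').re := ht'V.2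
    rw [ContinuousMap.add_apply, Complex.add_re]
    linarith
  · rw [map_add]
    exact (norm_add_le _ _).trans (by gcongr)

lemma IsNarrow.exists_le_re (hT : IsNarrow T) {U : Set K} (hU : IsOpen U) (hne : U.Nonempty)
    {η : ℝ} (hη : 0 < η) (n : ℕ) :
    ∃ S : C(K, ℂ), ∃ t ∈ U, (∀ s ∉ U, ‖S s‖ ≤ 1) ∧ ‖S‖ ≤ 2 * n ∧ (n : ℝ) / 2 ≤ (S t).re ∧
      ‖T S‖ ≤ n * η := by
  induction n with
  | zero =>
    obtain ⟨t, ht⟩ := hne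
    exact ⟨0, t, ht, by simp⟩
  | succ n ih =>
    obtain ⟨S, t, ht, hS, hnorm, hre, hTS⟩ := ih
    obtain ⟨S', t', ht', hS', hnorm', hre', hTS'⟩ := hT.exists_increment hU hS ht hη
    refine ⟨S', t', ht', hS', ?_, ?_, ?_⟩ <;> push_cast <;> linarith

lemma IsNarrow.exists_peak (hT : IsNarrow T) {U : Set K} (hU : IsOpen U) (hne : U.Nonempty)
    {δ : ℝ} (hδ : 0 < δ) :
    ∃ f : C(K, ℂ), ∃ t ∈ U, f t = 1 ∧ ‖f‖ ≤ 4 ∧ (∀ s ∉ U, ‖f s‖ ≤ δ) ∧ ‖T f‖ ≤ δ := by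
  obtain ⟨n, hn⟩ := exists_nat_gt (2 / δ)
  have hn0 : (0 : ℝ) < n := lt_trans (by positivity) hn
  obtain ⟨S, t, ht, hS, hnorm, hre, hTS⟩ := hT.exists_le_re hU hne (half_pos hδ) n
  have hSt : (n : ℝ) / 2 ≤ ‖S t‖ := hre.trans (Complex.re_le_norm _)
  have hpos : 0 < ‖S t‖ := lt_of_lt_of_le (by positivity) hSt
  have hinv : ‖(S t)⁻¹‖ ≤ 2 / n := by
    rw [norm_inv, inv_le_comm₀ hpos (by positivity), inv_div]
    exact hSt
  refine ⟨(S t)⁻¹ • S, t, ht, ?_, ?_, fun s hs => ?_, ?_⟩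
  · rw [ContinuousMap.smul_apply, smul_eq_mul, inv_mul_cancel₀ (norm_pos_iff.1 hpos)]
  · calc ‖(S t)⁻¹ • S‖ ≤ 2 / n * (2 * n) := by rw [norm_smul]; gcongr
      _ = 4 := by field_simp; norm_num
  · calc ‖((S t)⁻¹ • S) s‖ ≤ 2 / n * 1 := by
          rw [ContinuousMap.smul_apply, norm_smul]
          gcongr
          exact hS s hs
      _ ≤ δ := by rw [mul_one, div_le_comm₀ hn0 hδ]; exact hn.le
  · calc ‖T ((S t)⁻¹ • S)‖ ≤ 2 / n * (n * (δ / 2)) := by rw [map_smul, norm_smul]; gcongr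
      _ = δ := by field_simp

end Bump

/-! ### Narrow operators and the Daugavet property -/

section Daugavet

variable {X : Type*} [NormedAddCommGroup X] [NormedSpace ℂ X]

lemma le_norm_add_smul {x z : X} (hx : ‖x‖ ≤ 1) (hz : ‖z‖ ≤ 1) {δ : ℝ}
    (hxz : 2 - δ ≤ ‖x + z‖) {c : ℝ} (hc : 0 ≤ c) :
    (1 + c) * (1 - δ) ≤ ‖z + (c : ℂ) • x‖ := by
  have hsplit : ((1 + c : ℝ) : ℂ) • (x + z) = (z + (c : ℂ) • x) + (x + (c : ℂ) • z) := by
    push_cast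
    module
  have htri := norm_add_le (z + (c : ℂ) • x) (x + (c : ℂ) • z)
  rw [← hsplit, norm_smul, Complex.norm_real, Real.norm_of_nonneg (by positivity)] at htri
  have hsmall : ‖x + (c : ℂ) • z‖ ≤ 1 + c * 1 := by
    refine (norm_add_le _ _).trans (add_le_add hx ?_)
    rw [norm_smul, Complex.norm_real, Real.norm_of_nonneg hc]
    gcongr
  nlinarith

lemma exists_eq_smul_of_finrank_range_eq_one {R : X →L[ℂ] X}
    (hR : Module.finrank ℂ (LinearMap.range (R : X →ₗ[ℂ] X)) = 1) :
    ∃ w : X, ‖w‖ = 1 ∧ ∃ ψ : X →L[ℂ] ℂ, ∀ x, R x = ψ x • w := by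
  obtain ⟨v, hv0, hv⟩ := finrank_eq_one_iff'.1 hR
  have hnv : ‖(v : X)‖ ≠ 0 := norm_ne_zero_iff.2 fun h => hv0 (Subtype.ext h)
  have hnv' : (‖(v : X)‖ : ℂ) ≠ 0 := Complex.ofReal_ne_zero.2 hnv
  obtain ⟨g, -, hgv⟩ := exists_dual_vector ℂ (v : X) hnv
  refine ⟨(‖(v : X)‖⁻¹ : ℂ) • (v : X), ?_, g.comp R, fun x => ?_⟩
  · rw [norm_smul, norm_inv, Complex.norm_real, norm_norm, inv_mul_cancel₀ hnv]
  · obtain ⟨c, hc⟩ := hv ⟨R x, x, rfl⟩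
    have hcv : c • (v : X) = R x := congrArg Subtype.val hc
    have hgv' : g v = (‖(v : X)‖ : ℂ) := hgv
    rw [ContinuousLinearMap.comp_apply, ← hcv, map_smul, hgv', smul_smul, smul_eq_mul,
      mul_assoc, mul_inv_cancel₀ hnv', mul_one]

lemma exists_norm_eq_one_and_lt_apply {ψ : X →L[ℂ] ℂ} {a : ℝ} (ha : 0 ≤ a) (hψ : a < ‖ψ‖) :
    ∃ y : X, ‖y‖ = 1 ∧ ∃ c : ℝ, a < c ∧ ψ y = c := by
  obtain ⟨y, hy, hay⟩ := ψ.exists_nnnorm_eq_one_lt_apply_of_lt_opNNNorm (r := ⟨a, ha⟩) hψ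
  have hay' : a < ‖ψ y‖ := hay
  have hy' : ‖y‖ = 1 := congrArg NNReal.toReal hy
  have hpos : 0 < ‖ψ y‖ := ha.trans_lt hay'
  refine ⟨(conj (ψ y) / ‖ψ y‖) • y, ?_, ‖ψ y‖, hay', ?_⟩
  · rw [norm_smul, hy', mul_one, norm_div, Complex.norm_conj, Complex.norm_real, norm_norm,
      div_self hpos.ne']
  · rw [map_smul, smul_eq_mul, div_mul_eq_mul_div, Complex.conj_mul', sq,
      mul_div_cancel_right₀ _ (Complex.ofReal_ne_zero.2 hpos.ne')]

variable {E : Type*} [SeminormedAddCommGroup E] [NormedSpace ℂ E]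

lemma IsNarrow.le_norm_id_add {T : X →L[ℂ] E} (hT : IsNarrow T) {R : X →L[ℂ] X} {w : X}
    (hw : ‖w‖ = 1) {ψ : X →L[ℂ] ℂ} (hR : ∀ x, R x = ψ x • w) {y : X} (hy : ‖y‖ = 1) {c : ℝ}
    (hc : 0 ≤ c) (hψy : ψ y = c) : 1 + c ≤ ‖ContinuousLinearMap.id ℂ X + R‖ := by
  refine le_of_forall_pos_sub_le fun ε hε => ?_
  let δ : ℝ := ε / (2 + c)
  have hδ : 0 < δ := by positivity
  have hδε : (2 + c) * δ = ε := mul_div_cancel₀ ε (by positivity)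
  obtain ⟨z, hz, hyz, hwz⟩ := hT w (mem_sphere_zero_iff_norm.2 hw) y
    (mem_sphere_zero_iff_norm.2 hy) ψ δ hδ
  rw [mem_sphere_zero_iff_norm] at hz
  have hlow := le_norm_add_smul hw.le hz.le hwz hc
  have hψ : ‖ψ (y - z)‖ ≤ δ := (le_add_of_nonneg_left (norm_nonneg _)).trans hyz
  have hsplit : z + (c : ℂ) • w = (ContinuousLinearMap.id ℂ X + R) z + ψ (y - z) • w := by
    rw [add_apply, ContinuousLinearMap.id_apply, hR, map_sub, hψy]
    module
  have hup : ‖z + (c : ℂ) • w‖ ≤ ‖ContinuousLinearMap.id ℂ X + R‖ + δ := by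
    rw [hsplit]
    refine (norm_add_le _ _).trans (add_le_add (ContinuousLinearMap.unit_le_opNorm _ z hz.le) ?_)
    rwa [norm_smul, hw, mul_one]
  linarith

lemma IsNarrow.hasDaugavetProperty {T : X →L[ℂ] E} (hT : IsNarrow T) :
    HasDaugavetProperty X := by
  intro R hR
  obtain ⟨w, hw, ψ, hRψ⟩ := exists_eq_smul_of_finrank_range_eq_one hR
  have hRle : ‖R‖ ≤ ‖ψ‖ := R.opNorm_le_bound (norm_nonneg _) fun x => by
    rw [hRψ, norm_smul, hw, mul_one]
    exact ψ.le_opNorm x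
  have hR0 : R ≠ 0 := by
    rintro rfl
    rw [ContinuousLinearMap.toLinearMap_zero, LinearMap.range_zero, finrank_bot] at hR
    exact zero_ne_one hR
  refine le_antisymm ((norm_add_le _ _).trans
    (add_le_add_left ContinuousLinearMap.norm_id_le _)) ?_
  rw [← le_sub_iff_add_le']
  refine le_of_forall_lt_imp_le_of_dense fun a ha => ?_
  obtain ⟨y, hy, c, hc, hψy⟩ := exists_norm_eq_one_and_lt_apply (le_max_right a 0)
    (max_lt (ha.trans_le hRle) ((norm_pos_iff.2 hR0).trans_le hRle))
  rw [max_lt_iff] at hc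
  linarith [hT.le_norm_id_add hw hRψ hy hc.2.le hψy]

end Daugavet

/-! ### Atoms of regular complex measures -/

lemma isDiffuse_of_forall_singleton {K : Type*} [MeasurableSpace K] [MeasurableSingletonClass K]
    {μ : ComplexMeasure K} (h : ∀ t, μ {t} = 0) : IsDiffuse μ := by
  intro B hB
  have hvar : μ.variation B = 0 := by
    rw [← Set.biUnion_of_singleton B, measure_biUnion_null_iff hB]
    exact fun t _ => variation_singleton_eq_zero (h t)
  have hle := VectorMeasure.enorm_measure_le_variation μ B
  rwa [hvar, nonpos_iff_eq_zero, enorm_eq_zero] at hle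

section Atoms

variable {K : Type*} [TopologicalSpace K] [T2Space K] [MeasurableSpace K] [BorelSpace K]
  {μ : ComplexMeasure K}

lemma exists_isOpen_variation_lt [CompactSpace K] (hμ : IsRegularMeasure μ) (t : K) {ε : ℝ}
    (hε : 0 < ε) : ∃ W : Set K, IsOpen W ∧ t ∈ W ∧ μ.variation.real (W \ {t}) < ε := by
  have : μ.variation.Regular := hμ
  have := hμ.isFiniteMeasure_variation
  obtain ⟨W, htW, hW, -, hlt⟩ := (measurableSet_singleton t).exists_isOpen_sdiff_lt
    (μ := μ.variation) (measure_ne_top _ _) (ENNReal.ofReal_pos.2 hε).ne'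
  exact ⟨W, hW, htW rfl, ENNReal.toReal_lt_of_lt_ofReal hlt⟩

variable [CompactSpace K]

lemma norm_pairing_sub_le_setIntegral (hμ : IsRegularMeasure μ) (f : C(K, ℂ)) (t : K) :
    ‖pairing μ f - f t * μ {t}‖ ≤ ∫ s in {t}ᶜ, ‖f s‖ ∂μ.variation := by
  have := hμ.isFiniteMeasure_variation
  have ht := measurableSet_singleton t
  have hatom : (μ.restrict {t}).integral f (ContinuousLinearMap.mul ℝ ℂ) = f t * μ {t} := by
    rw [VectorMeasure.setIntegral_congr_fun (g := fun _ => f t) (fun s hs => by rw [hs]),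
      VectorMeasure.integral_const, VectorMeasure.restrict_apply _ ht MeasurableSet.univ,
      Set.univ_inter, ContinuousLinearMap.mul_apply']
  rw [pairing, ← VectorMeasure.setIntegral_add_compl ht (integrable_continuousMap _ f), hatom,
    add_sub_cancel_left, ← VectorMeasure.variation_restrict ht.compl]
  exact norm_pairing_le_integral_norm (μ.restrict {t}ᶜ) f

lemma norm_pairing_sub_le (hμ : IsRegularMeasure μ) {f : C(K, ℂ)} {t : K} {W : Set K}
    (hW : MeasurableSet W) {C δ : ℝ} (hC : ‖f‖ ≤ C) (hδ : 0 ≤ δ) (hf : ∀ s ∉ W, ‖f s‖ ≤ δ) :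
    ‖pairing μ f - f t * μ {t}‖ ≤
      C * μ.variation.real (W \ {t}) + δ * μ.variation.real Set.univ := by
  have := hμ.isFiniteMeasure_variation
  refine (norm_pairing_sub_le_setIntegral hμ f t).trans ?_
  have hnear : ∫ s in {t}ᶜ ∩ W, ‖f s‖ ∂μ.variation ≤ C * μ.variation.real ({t}ᶜ ∩ W) :=
    (Real.le_norm_self _).trans (norm_setIntegral_le_of_norm_le_const (measure_lt_top _ _)
      fun s _ => (norm_norm (f s)).trans_le ((f.norm_coe_le_norm s).trans hC))
  have hfar : ∫ s in {t}ᶜ \ W, ‖f s‖ ∂μ.variation ≤ δ * μ.variation.real ({t}ᶜ \ W) :=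
    (Real.le_norm_self _).trans (norm_setIntegral_le_of_norm_le_const (measure_lt_top _ _)
      fun s hs => (norm_norm (f s)).trans_le (hf s hs.2))
  rw [← integral_inter_add_sdiff hW (integrable_continuousMap _ f).norm.integrableOn,
    Set.sdiff_eq W, Set.inter_comm W]
  exact add_le_add hnear (hfar.trans
    (mul_le_mul_of_nonneg_left (measureReal_mono (Set.subset_univ _)) hδ))

lemma exists_isOpen_forall_norm_pairing_lt (hμ : IsRegularMeasure μ) {t : K} (ht : μ {t} = 0)
    {η : ℝ} (hη : 0 < η) :
    ∃ W : Set K, IsOpen W ∧ t ∈ W ∧ ∀ f ∈ bumpFunctions W t, ‖pairing μ (complexify K f)‖ < η := by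
  obtain ⟨W, hW, htW, hlt⟩ := exists_isOpen_variation_lt hμ t hη
  refine ⟨W, hW, htW, fun f hf => ?_⟩
  have hle := norm_pairing_sub_le hμ (t := t) hW.measurableSet (norm_complexify_bump hf).le le_rfl
    fun s hs => by simp [hf.2.1 s hs]
  rw [ht, mul_zero, sub_zero, one_mul, zero_mul, add_zero] at hle
  exact hle.trans_lt hlt

lemma countable_setOf_singleton_ne_zero (hμ : IsRegularMeasure μ) :
    {t : K | μ {t} ≠ 0}.Countable := by
  have := hμ.isFiniteMeasure_variation
  refine (Measure.countable_meas_pos_of_disjoint_iUnion (μ := μ.variation)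
    (fun t : K => measurableSet_singleton t)
    fun s t hst => Set.disjoint_singleton.2 hst).mono fun t ht => ?_
  exact (enorm_pos.2 ht).trans_le (VectorMeasure.enorm_measure_le_variation μ {t})

end Atoms

section Group

variable {G : Type*} [Group G] [TopologicalSpace G] [IsTopologicalGroup G] [CompactSpace G]

lemma punctured_nhds_one_neBot [Infinite G] : (nhdsWithin (1 : G) {1}ᶜ).NeBot := by
  rw [Filter.neBot_iff, ne_eq, ← isOpen_singleton_iff_punctured_nhds]
  intro h
  have : DiscreteTopology G := discreteTopology_of_isOpen_singleton_one h
  exact not_finite_iff_infinite.2 ‹Infinite G› finite_of_compact_of_discrete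

variable [T2Space G]

lemma not_countable_of_isOpen [Infinite G] {U : Set G} (hU : IsOpen U) (hne : U.Nonempty) :
    ¬ U.Countable := by
  borelize G
  have := punctured_nhds_one_neBot (G := G)
  exact fun h => (hU.measure_pos Measure.haar hne).ne' (h.measure_zero Measure.haar)

variable [MeasurableSpace G] [BorelSpace G]

lemma exists_mem_singleton_eq_zero [Infinite G] {U : Set G} (hU : IsOpen U) (hne : U.Nonempty)
    {μ : ComplexMeasure G} (hμ : IsRegularMeasure μ) : ∃ t ∈ U, μ {t} = 0 := by
  by_contra! h
  exact not_countable_of_isOpen hU hne ((countable_setOf_singleton_ne_zero hμ).mono h)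

end Group

/-! ### Functionals without an atom at a point -/

lemma exists_norm_lt_of_convex {F : Type*} [SeminormedAddCommGroup F] [NormedSpace ℂ F]
    {D : Set F} (hD : Convex ℝ D)
    (hweak : ∀ χ : F →L[ℂ] ℂ, ∀ η > 0, ∃ d ∈ D, ‖χ d‖ < η) {δ : ℝ} (hδ : 0 < δ) :
    ∃ d ∈ D, ‖d‖ < δ := by
  by_contra! hfar
  have hdisj : Disjoint (Metric.ball 0 δ) D :=
    Set.disjoint_right.2 fun d hd hball => (hfar d hd).not_gt (mem_ball_zero_iff.1 hball)
  obtain ⟨χ, u, hball, hχD⟩ := RCLike.geometric_hahn_banach_open (𝕜 := ℂ) (convex_ball _ δ)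
    Metric.isOpen_ball hD hdisj
  have hu : 0 < u := by simpa using hball 0 (Metric.mem_ball_self hδ)
  obtain ⟨d, hd, hlt⟩ := hweak χ u hu
  exact ((hχD d hd).trans (RCLike.re_le_norm _)).not_gt hlt

section NoAtom

variable {K : Type*} [TopologicalSpace K]

lemma bumpFunctions_mono {U V : Set K} (h : U ⊆ V) (t : K) :
    bumpFunctions U t ⊆ bumpFunctions V t :=
  fun _ hf => ⟨hf.1, fun s hs => hf.2.1 s fun hsU => hs (h hsU), hf.2.2⟩

lemma convex_bumpFunctions (U : Set K) (t : K) : Convex ℝ (bumpFunctions U t) := by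
  intro f hf g hg a b ha hb hab
  refine ⟨?_, fun s hs => ?_, fun s => ?_⟩
  · simp [hf.1, hg.1, hab]
  · simp [hf.2.1 s hs, hg.2.1 s hs]
  · exact convex_Icc (0 : ℝ) 1 (hf.2.2 s) (hg.2.2 s) ha hb hab

/-- A functional has no atom at `t` if it is small on the functions that peak at `t` and vanish
off a small neighbourhood of `t`; for a functional given by a regular complex measure `μ` this
follows from `μ {t} = 0`. -/
def HasNoAtomAt (ψ : C(K, ℂ) →L[ℂ] ℂ) (t : K) : Prop :=
  ∀ η > 0, ∃ W : Set K, IsOpen W ∧ t ∈ W ∧ ∀ f ∈ bumpFunctions W t, ‖ψ (complexify K f)‖ < η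

lemma HasNoAtomAt.add {ψ φ : C(K, ℂ) →L[ℂ] ℂ} {t : K} (hψ : HasNoAtomAt ψ t)
    (hφ : HasNoAtomAt φ t) : HasNoAtomAt (ψ + φ) t := by
  intro η hη
  obtain ⟨V, hV, htV, hψV⟩ := hψ (η / 2) (half_pos hη)
  obtain ⟨W, hW, htW, hφW⟩ := hφ (η / 2) (half_pos hη)
  refine ⟨V ∩ W, hV.inter hW, ⟨htV, htW⟩, fun f hf => ?_⟩
  calc ‖(ψ + φ) (complexify K f)‖
      ≤ ‖ψ (complexify K f)‖ + ‖φ (complexify K f)‖ := norm_add_le _ _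
    _ < η / 2 + η / 2 := add_lt_add (hψV f (bumpFunctions_mono Set.inter_subset_left t hf))
        (hφW f (bumpFunctions_mono Set.inter_subset_right t hf))
    _ = η := add_halves η

lemma HasNoAtomAt.comp {φ : C(K, ℂ) →L[ℂ] ℂ} {t : K} (hφ : HasNoAtomAt φ t)
    (χ : ℂ →L[ℂ] ℂ) : HasNoAtomAt (χ.comp φ) t := by
  intro η hη
  obtain ⟨W, hW, htW, hφW⟩ := hφ (η / (‖χ‖ + 1)) (by positivity)
  refine ⟨W, hW, htW, fun f hf => ?_⟩
  calc ‖χ (φ (complexify K f))‖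
      ≤ ‖χ‖ * ‖φ (complexify K f)‖ := χ.le_opNorm _
    _ ≤ (‖χ‖ + 1) * ‖φ (complexify K f)‖ := by gcongr; exact le_add_of_nonneg_right zero_le_one
    _ < η := by rw [← lt_div_iff₀' (by positivity)]; exact hφW f hf

variable [CompactSpace K] [T2Space K]

/-- The images of the bumps under `T` form a convex set, so it suffices to make them weakly
small. -/
lemma exists_bump_norm_lt {E : Type*} [SeminormedAddCommGroup E] [NormedSpace ℂ E]
    {T : C(K, ℂ) →L[ℂ] E} {t : K} (hT : ∀ χ : E →L[ℂ] ℂ, HasNoAtomAt (χ.comp T) t) {U : Set K}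
    (hU : IsOpen U) (ht : t ∈ U) {δ : ℝ} (hδ : 0 < δ) :
    ∃ f ∈ bumpFunctions U t, ‖T (complexify K f)‖ < δ := by
  let L : C(K, ℝ) →L[ℝ] E := (T.restrictScalars ℝ).comp (complexify K)
  have hconvex : Convex ℝ (L '' bumpFunctions U t) :=
    (convex_bumpFunctions U t).linear_image L.toLinearMap
  obtain ⟨_, ⟨f, hf, rfl⟩, hlt⟩ := exists_norm_lt_of_convex hconvex (fun χ η hη => by
    obtain ⟨W, hW, htW, hχ⟩ := hT χ η hη
    obtain ⟨f, hf⟩ := bumpFunctions_nonempty (hU.inter hW) ⟨ht, htW⟩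
    exact ⟨L f, ⟨f, bumpFunctions_mono Set.inter_subset_left t hf, rfl⟩,
      hχ f (bumpFunctions_mono Set.inter_subset_right t hf)⟩) hδ
  exact ⟨f, hf, hlt⟩

theorem isNarrow_of_forall_hasNoAtomAt [Nonempty K] {E : Type*} [SeminormedAddCommGroup E]
    [NormedSpace ℂ E] {T : C(K, ℂ) →L[ℂ] E}
    (h : ∀ U : Set K, IsOpen U → U.Nonempty → ∀ φ : C(K, ℂ) →L[ℂ] ℂ,
      ∃ t ∈ U, HasNoAtomAt φ t ∧ ∀ χ : E →L[ℂ] ℂ, HasNoAtomAt (χ.comp T) t) : IsNarrow T := by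
  refine isNarrow_of_exists_bump fun U hU hne φ δ hδ => ?_
  obtain ⟨t, ht, hφ, hT⟩ := h U hU hne φ
  have hprod (χ : E × ℂ →L[ℂ] ℂ) : HasNoAtomAt (χ.comp (T.prod φ)) t := by
    have hsplit : χ.comp (T.prod φ) = (χ.comp (ContinuousLinearMap.inl ℂ E ℂ)).comp T +
        (χ.comp (ContinuousLinearMap.inr ℂ E ℂ)).comp φ := by
      ext f
      simp [← map_add]
    rw [hsplit]
    exact (hT _).add (hφ.comp _)
  obtain ⟨f, hf, hlt⟩ := exists_bump_norm_lt hprod hU ht hδ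
  exact ⟨t, ht, f, hf, (norm_fst_le _).trans hlt.le, (norm_snd_le _).trans hlt.le⟩

variable [MeasurableSpace K] [BorelSpace K]

lemma hasNoAtomAt_of_singleton_eq_zero {μ : ComplexMeasure K} (hμ : IsRegularMeasure μ)
    {φ : C(K, ℂ) →L[ℂ] ℂ} (hφ : ∀ f, φ f = pairing μ f) {t : K} (ht : μ {t} = 0) :
    HasNoAtomAt φ t := by
  intro η hη
  simpa only [hφ] using exists_isOpen_forall_norm_pairing_lt hμ ht hη

end NoAtom

/-! ### Rich subspaces and semi-Riesz sets -/

lemma norm_apply_le_mul_norm_mkQL {X F : Type*} [NormedAddCommGroup X] [NormedSpace ℂ X]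
    [SeminormedAddCommGroup F] [NormedSpace ℂ F] {Y : Submodule ℂ X} {S : X →L[ℂ] F}
    (hS : ∀ y ∈ Y, S y = 0) (x : X) : ‖S x‖ ≤ ‖S‖ * ‖Y.mkQL x‖ :=
  QuotientAddGroup.norm_lift_apply_le (S := Y.toAddSubgroup)
    (S.toLinearMap.toAddMonoidHom.mkNormedAddGroupHom ‖S‖ S.le_opNorm) hS (Y.mkQ x)

lemma norm_pairing_le_mul_norm_mkQL {K : Type*} [TopologicalSpace K] [CompactSpace K]
    [MeasurableSpace K] [OpensMeasurableSpace K] {Y : Submodule ℂ C(K, ℂ)} {μ : ComplexMeasure K}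
    (hμ : IsRegularMeasure μ) (hY : ∀ f ∈ Y, pairing μ f = 0) (f : C(K, ℂ)) :
    ‖pairing μ f‖ ≤ μ.variation.real Set.univ * ‖Y.mkQL f‖ := by
  have := hμ.isFiniteMeasure_variation
  refine (norm_apply_le_mul_norm_mkQL (S := pairingCLM μ hμ) hY f).trans ?_
  gcongr
  exact (pairingCLM μ hμ).opNorm_le_bound measureReal_nonneg
    (norm_pairing_le_variation_mul_norm μ)

lemma fourierStieltjes_eq_pairing {G : Type*} [CommGroup G] [TopologicalSpace G]
    [MeasurableSpace G] (μ : ComplexMeasure G) (γ : PontryaginDual G) :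
    fourierStieltjes μ γ = pairing μ (character G γ⁻¹) := by
  rw [character_inv]
  rfl

section Group

variable {G : Type*} [CommGroup G] [TopologicalSpace G] [IsTopologicalGroup G] [CompactSpace G]
  [MeasurableSpace G] [BorelSpace G]

lemma fourierCoefficient_character_of_ne {γ δ : PontryaginDual G} (h : γ ≠ δ) :
    fourierCoefficient (character G γ) δ = 0 := by
  obtain ⟨t, ht⟩ : ∃ t, γ t ≠ δ t := by
    by_contra! heq
    exact h (PontryaginDual.ext heq)
  have htranslate : translate (character G γ) t = (γ t : ℂ) • character G γ := by
    ext x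
    simp
  have hcoeff := fourierCoefficient_translate (character G γ) t δ
  rw [htranslate, fourierCoefficient_smul, mul_eq_mul_right_iff] at hcoeff
  exact hcoeff.resolve_left fun hγδ => ht (Subtype.ext hγδ)

lemma character_mem_continuousWithSpec {Λ : Set (PontryaginDual G)} {γ : PontryaginDual G}
    (hγ : γ ∈ Λ) : character G γ ∈ continuousWithSpec Λ := by
  intro δ hδ
  by_contra hδΛ
  exact hδ (fourierCoefficient_character_of_ne fun h => hδΛ (h ▸ hγ))

lemma continuous_fourierCoefficient (γ : PontryaginDual G) :
    Continuous fun f : C(G, ℂ) => fourierCoefficient f γ := by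
  let L : C(G, ℂ) →ₗ[ℂ] ℂ :=
    { toFun := fun f => fourierCoefficient f γ
      map_add' := fun f g => fourierCoefficient_add f g γ
      map_smul' := fun c f => fourierCoefficient_smul c f γ }
  refine (L.mkContinuous 1 fun f => ?_).continuous
  refine (norm_integral_le_of_norm_le_const (C := ‖f‖) (.of_forall fun x => ?_)).trans (by simp)
  rw [norm_mul, Complex.norm_conj, Circle.norm_coe, one_mul]
  exact f.norm_coe_le_norm x

lemma isClosed_continuousWithSpec (Λ : Set (PontryaginDual G)) :
    IsClosed (continuousWithSpec Λ : Set C(G, ℂ)) := by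
  have hinter : (continuousWithSpec Λ : Set C(G, ℂ)) =
      ⋂ γ ∈ Λᶜ, {f | fourierCoefficient f γ = 0} := by
    ext f
    simp only [Set.mem_iInter, Set.mem_ofPred_eq]
    exact forall_congr' fun γ => not_imp_comm
  rw [hinter]
  exact isClosed_biInter fun γ _ => isClosed_eq (continuous_fourierCoefficient γ) continuous_const

lemma norm_mkQL_translate_le {Λ : Set (PontryaginDual G)} (f : C(G, ℂ)) (t : G) :
    ‖(continuousWithSpec Λ).mkQL (translate f t)‖ ≤ ‖(continuousWithSpec Λ).mkQL f‖ := by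
  let S : C(G, ℂ) →L[ℂ] C(G, ℂ) ⧸ continuousWithSpec Λ :=
    (continuousWithSpec Λ).mkQL.comp (ContinuousMap.compCLM ℂ ℂ (ContinuousMap.mulLeft t))
  have hS : ‖S‖ ≤ 1 := S.opNorm_le_bound zero_le_one fun g => by
    rw [one_mul]
    exact (Submodule.Quotient.norm_mk_le _ _).trans (norm_translate_le _ _)
  calc ‖S f‖ ≤ ‖S‖ * ‖(continuousWithSpec Λ).mkQL f‖ :=
        norm_apply_le_mul_norm_mkQL (fun y hy => (Submodule.Quotient.mk_eq_zero _).2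
          (translate_mem_continuousWithSpec hy t)) f
    _ ≤ _ := mul_le_of_le_one_left (norm_nonneg _) hS

variable [T2Space G]

lemma measureSpec_subset_iff {Λ : Set (PontryaginDual G)} {μ : ComplexMeasure G}
    (hμ : IsRegularMeasure μ) :
    measureSpec μ ⊆ Set.univ \ Λ⁻¹ ↔ ∀ f ∈ continuousWithSpec Λ, pairing μ f = 0 := by
  constructor
  · intro h f hf
    refine apply_eq_zero_of_mem_continuousWithSpec (pairingCLM μ hμ) (fun γ hγ => ?_) hf
    by_contra hne
    refine (h (a := γ⁻¹) ?_).2 (Set.inv_mem_inv.2 hγ)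
    rwa [measureSpec, Set.mem_ofPred_eq, fourierStieltjes_eq_pairing, inv_inv]
  · intro h γ hγ
    refine ⟨trivial, fun hγΛ => hγ ?_⟩
    rw [fourierStieltjes_eq_pairing]
    exact h _ (character_mem_continuousWithSpec hγΛ)

/-- Since `C_Λ(G)` is translation invariant, the peak can be moved to any given point. -/
lemma exists_peak_at_of_isNarrow_mkQL {Λ : Set (PontryaginDual G)}
    (hΛ : IsNarrow (continuousWithSpec Λ).mkQL) {W : Set G} (hW : IsOpen W) {x : G} (hx : x ∈ W)
    {δ : ℝ} (hδ : 0 < δ) :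
    ∃ f : C(G, ℂ), f x = 1 ∧ ‖f‖ ≤ 4 ∧ (∀ s ∉ W, ‖f s‖ ≤ δ) ∧
      ‖(continuousWithSpec Λ).mkQL f‖ ≤ δ := by
  have hopen : IsOpen {p : G × G | x * p.1⁻¹ * p.2 ∈ W} := hW.preimage (by fun_prop)
  obtain ⟨U₁, U₂, hU₁, hU₂, h₁, h₂, hU⟩ := isOpen_prod_iff.1 hopen 1 1 (by simpa using hx)
  obtain ⟨f, t, ht, hft, hf, hfU, hTf⟩ := hΛ.exists_peak (hU₁.inter hU₂) ⟨1, h₁, h₂⟩ hδ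
  refine ⟨translate f (t * x⁻¹), ?_, ?_, fun s hs => hfU _ fun hsU => hs ?_, ?_⟩
  · rw [translate_apply, inv_mul_cancel_right, hft]
  · exact (norm_translate_le _ _).trans hf
  · have hmem : x * t⁻¹ * (t * x⁻¹ * s) ∈ W := hU (Set.mk_mem_prod ht.1 hsU.2)
    rwa [show x * t⁻¹ * (t * x⁻¹ * s) = s by group] at hmem
  · exact (norm_mkQL_translate_le f _).trans hTf

theorem isSemiRiesz_of_isNarrow {Λ : Set (PontryaginDual G)}
    (hΛ : IsNarrow (continuousWithSpec Λ).mkQL) : IsSemiRiesz (Set.univ \ Λ⁻¹) := by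
  intro μ hμ hspec
  have hann := (measureSpec_subset_iff hμ).1 hspec
  refine isDiffuse_of_forall_singleton fun x =>
    norm_le_zero_iff.1 (le_of_forall_pos_le_add fun ε hε => ?_)
  rw [zero_add]
  let M : ℝ := μ.variation.real Set.univ
  have hM : 0 ≤ M := measureReal_nonneg
  let δ : ℝ := ε / (4 * (M + 1))
  have hδ : 0 < δ := by positivity
  have hδM : δ * M ≤ ε / 4 := by
    have hδε : δ * (4 * (M + 1)) = ε := div_mul_cancel₀ _ (by positivity)
    linarith
  obtain ⟨W, hW, hxW, hWx⟩ := exists_isOpen_variation_lt hμ x (ε := ε / 8) (by positivity)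
  obtain ⟨f, hfx, hf, hfW, hfΛ⟩ := exists_peak_at_of_isNarrow_mkQL hΛ hW hxW hδ
  have hpairing : ‖pairing μ f‖ ≤ M * δ := (norm_pairing_le_mul_norm_mkQL hμ hann f).trans
    (mul_le_mul_of_nonneg_left hfΛ hM)
  have hatom : ‖pairing μ f - μ {x}‖ ≤ 4 * μ.variation.real (W \ {x}) + δ * M := by
    simpa only [hfx, one_mul] using norm_pairing_sub_le hμ (t := x) hW.measurableSet hf hδ.le hfW
  linarith [norm_le_insert (pairing μ f) (μ {x})]

theorem isNarrow_of_isSemiRiesz [Infinite G] {Λ : Set (PontryaginDual G)}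
    (hΛ : IsSemiRiesz (Set.univ \ Λ⁻¹)) : IsNarrow (continuousWithSpec Λ).mkQL := by
  refine isNarrow_of_forall_hasNoAtomAt fun U hU hne φ => ?_
  obtain ⟨μ, hμ, hφμ⟩ := exists_isRegularMeasure_eq_pairing φ
  obtain ⟨t, ht, hμt⟩ := exists_mem_singleton_eq_zero hU hne hμ
  refine ⟨t, ht, hasNoAtomAt_of_singleton_eq_zero hμ hφμ hμt, fun χ => ?_⟩
  obtain ⟨ν, hν, hψν⟩ :=
    exists_isRegularMeasure_eq_pairing (χ.comp (continuousWithSpec Λ).mkQL)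
  have hann : ∀ f ∈ continuousWithSpec Λ, pairing ν f = 0 := fun f hf => by
    have hmk : (continuousWithSpec Λ).mkQL f = 0 := (Submodule.Quotient.mk_eq_zero _).2 hf
    rw [← hψν, ContinuousLinearMap.comp_apply, hmk, map_zero]
  exact hasNoAtomAt_of_singleton_eq_zero hν hψν
    (hΛ ν hν ((measureSpec_subset_iff hν).2 hann) {t} (Set.countable_singleton t))

end Group

end HarmonicBanach

theorem mainTheorem1 {G : Type*} [CommGroup G] [TopologicalSpace G] [IsTopologicalGroup G]
    [CompactSpace G] [T2Space G] [Infinite G] [MeasurableSpace G] [BorelSpace G]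
    (Λ : Set (PontryaginDual G)) :
    HarmonicBanach.IsRich (HarmonicBanach.continuousWithSpec Λ) ↔
      HarmonicBanach.IsSemiRiesz (Set.univ \ Λ⁻¹) := by
  refine ⟨fun h => HarmonicBanach.isSemiRiesz_of_isNarrow h.narrow, fun h => ?_⟩
  have hnarrow := HarmonicBanach.isNarrow_of_isSemiRiesz h
  exact ⟨hnarrow.hasDaugavetProperty, HarmonicBanach.isClosed_continuousWithSpec Λ, hnarrow⟩
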